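/- Let $n\ge 0$ and let $t_1,\dots,t_n>0$ be real numbers that are linearly independent over $\mathbb{Q}$. Let $\mathcal G$ be the class of all connected graphs $\Gamma$ with a distinguished vertex (the root, or source) whose edges are $e_1,\dots,e_n$, the edge $e_i$ having length $t_i$; here either loops and multiple edges are allowed throughout, or they are excluded throughout. For $\Gamma\in\mathcal G$ consider the following dynamical system. At time $0$ one point leaves the root along every edge incident to it, with unit speed. Whenever one or more points arrive at a vertex of degree $\rho$ at the same time, they are replaced by $\rho$ points, which leave the vertex along all the edges incident to it (a loop counts twice in the degree, and is left in both directions). Let $N_\Gamma(T)$ be the number of points moving along $\Gamma$ at time $T$, where at a discontinuity the value is half the sum of the limits on the left and on the right. Suppose that $\Gamma\in\mathcal G$ has minimal growth, that is, no $\Gamma'\in\mathcal G$ grows strictly slower: whenever $\Gamma'\in\mathcal G$ satisfies $N_{\Gamma'}(T)\le N_\Gamma(T)$ for all sufficiently large $T$, then also $N_\Gamma(T)\le N_{\Gamma'}(T)$ for all sufficiently large $T$. Then: 1) $\Gamma$ is a tree in which every vertex other than the root has degree $1$ or $2$; that is, $\Gamma$ is a union of simple chains outgoing from the root, no two of which have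 a common edge or a common vertex other than the root; 2) if $n\ge 2$, each of these chains has at least $2$ edges. -/

import Mathlib

/-- A graph with a distinguished vertex (the source, or root), built from the `n` edges
`0, …, n - 1`. Each edge has two ends, labelled by `Bool`; the ends of different edges, or the two
ends of one edge, may be glued together at vertices in any way (loops and multiple edges are
allowed). The labelling of the ends has no further meaning. -/
structure SourcedGraph (n : ℕ) where
  V : Type
  root : V
  endpt : Fin n → Bool → V

namespace SourcedGraph

variable {n : ℕ} (Γ : SourcedGraph n)

/-- The initial vertex of the directed edge `(e, b)`, which leaves the end `b` of `e`. -/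
def tail (d : Fin n × Bool) : Γ.V := Γ.endpt d.1 d.2

/-- The final vertex of the directed edge `(e, b)`. -/
def head (d : Fin n × Bool) : Γ.V := Γ.endpt d.1 (!d.2)

/-- `Γ.IsWalk u p v`: the directed edges in the list `p` form a walk from `u` to `v`. -/
def IsWalk : Γ.V → List (Fin n × Bool) → Γ.V → Prop
  | u, [], v => u = v
  | u, d :: p, v => Γ.tail d = u ∧ IsWalk (Γ.head d) p v

def Connected : Prop := ∀ u v : Γ.V, ∃ p, Γ.IsWalk u p v

/-- No loops and no two edges with the same pair of ends. -/
def IsSimple : Prop :=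
  (∀ e, Γ.endpt e false ≠ Γ.endpt e true) ∧
  ∀ e f, s(Γ.endpt e false, Γ.endpt e true) = s(Γ.endpt f false, Γ.endpt f true) → e = f

/-- No nonempty closed walk traverses each edge at most once. -/
def Acyclic : Prop :=
  ∀ (v : Γ.V) (p : List (Fin n × Bool)), Γ.IsWalk v p v → (p.map Prod.fst).Nodup → p = []

def IsTree : Prop := Γ.Connected ∧ Γ.Acyclic

/-- The degree of a vertex; a loop counts twice. -/
noncomputable def degree (v : Γ.V) : ℕ := {d : Fin n × Bool | Γ.tail d = v}.ncard

/-- A chain outgoing from the root: a nonempty walk from the root that visits no vertex twice. -/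
def IsRootChain (p : List (Fin n × Bool)) : Prop :=
  p ≠ [] ∧ (∃ v, Γ.IsWalk Γ.root p v) ∧ (Γ.root :: p.map Γ.head).Nodup

/-- `Γ` is the union of the chains `C i` outgoing from the root, which have no common edges and no
common vertices other than the root. -/
def IsUnionOfRootChains {k : ℕ} (C : Fin k → List (Fin n × Bool)) : Prop :=
  (∀ i, Γ.IsRootChain (C i)) ∧
  (∀ i j, i ≠ j → List.Disjoint ((C i).map Γ.head) ((C j).map Γ.head)) ∧
  (∀ e : Fin n, ∃! i, e ∈ (C i).map Prod.fst) ∧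
  ∀ v : Γ.V, v = Γ.root ∨ ∃ i, v ∈ (C i).map Γ.head

/-- `Γ.Emits t v s`: at the time `s` the vertex `v` sends out one point along each directed edge
leaving it, when the edge `e` has length `t e` and the points have unit speed. This happens at the
source at time `0`, and at any vertex whenever at least one point arrives there. Points that arrive
at the same vertex at the same time are merged. -/
inductive Emits (t : Fin n → ℝ) : Γ.V → ℝ → Prop
  | start : Emits t Γ.root 0
  | arrive (d : Fin n × Bool) (s : ℝ) : Emits t (Γ.tail d) s → Emits t (Γ.head d) (s + t d.1)

/-- The points moving just after the time `T`. A point is given by the directed edge `d` along which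
it moves and the time `s` at which it left `Γ.tail d`. -/
def pointsAfter (t : Fin n → ℝ) (T : ℝ) : Set ((Fin n × Bool) × ℝ) :=
  {x | Γ.Emits t (Γ.tail x.1) x.2 ∧ x.2 ≤ T ∧ T < x.2 + t x.1.1}

/-- The points moving just before the time `T`. -/
def pointsBefore (t : Fin n → ℝ) (T : ℝ) : Set ((Fin n × Bool) × ℝ) :=
  {x | Γ.Emits t (Γ.tail x.1) x.2 ∧ x.2 < T ∧ T ≤ x.2 + t x.1.1}

/-- The number `N(T)` of points moving along the graph at the time `T`; at a discontinuity it is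
half the sum of the limits on the left and on the right. -/
noncomputable def N (t : Fin n → ℝ) (T : ℝ) : ℝ :=
  (((Γ.pointsBefore t T).ncard : ℝ) + ((Γ.pointsAfter t T).ncard : ℝ)) / 2

/-- `Γ` grows no faster than `Γ'`. -/
def GrowsNoFaster (t : Fin n → ℝ) (Γ Γ' : SourcedGraph n) : Prop :=
  ∀ᶠ T in Filter.atTop, Γ.N t T ≤ Γ'.N t T

/-- `Γ` is a graph of minimal growth in the class `𝒢`: no graph of the class grows strictly
slower, i.e. it is a minimal element of `𝒢` for the preorder `GrowsNoFaster`. -/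
def GrowsMinimally (t : Fin n → ℝ) (𝒢 : Set (SourcedGraph n)) (Γ : SourcedGraph n) : Prop :=
  Γ ∈ 𝒢 ∧ ∀ Γ' ∈ 𝒢, GrowsNoFaster t Γ' Γ → GrowsNoFaster t Γ Γ'

end SourcedGraph

/-! ### Counting points by births -/

namespace SourcedGraph

variable {n : ℕ}

/-! A point reflected at the end of its edge replaces itself, so the number of moving points is the
number of births so far, a birth being a departure with no simultaneous arrival along the same edge
(`ncard_points_eq`). Comparing growth thus means counting births.

Every connected graph arises from a rooted tree with the same edges by gluing vertices
(`Connected.exists_treeGraph`). Gluing can only add departures. If it eventually adds none, it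
identifies no two vertices: by rational independence a departure time determines how often each edge
was traversed, and in a tree the parities of these numbers determine the vertex
(`injective_of_growsNoFaster`). Hence a minimal graph is a tree, and the births in a tree are
explicit integer vectors (`IsRanked.mem_births_iff`).

Suppose that two edges `b` and `c` hang from the lower end of `g`. Reattach the branch of `b` at the
upper end of `g`. Apart from exceptions, the births in this branch match births of the old tree with
one traversal of `g` fewer, so they come later by `t g`, and the old births along `b` in the window
`(T - t g, T]` are left over. The exceptional vectors vanish at both `g` and `c` and have one more
coordinate confined to boundedly many values, so there are only `O(T ^ (n - 3))` of them. The
leftover births exceed any fixed multiple of `T ^ (n - 3)`, because the combinations of `2 * t g`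
and `2 * t c` are arbitrarily dense in distant windows. So the new tree grows strictly slower
(`exists_ncard_treeBirths_lt`), and in a minimal tree no vertex but the root has two children.

If a chain has a single edge and there are other edges, moving the root to its far end delays the
whole process by the length of that edge. This is strictly slower, since births along another edge
at the root occur at arbitrarily late times (`reroot_growth`). -/

/-- The total length of a walk that traverses each edge `e` exactly `m e` times. -/
def weight (t : Fin n → ℝ) (m : Fin n → ℕ) : ℝ := ∑ e, (m e : ℝ) * t e

theorem weight_zero (t : Fin n → ℝ) : weight t 0 = 0 := by simp [weight]

theorem weight_add (t : Fin n → ℝ) (m m' : Fin n → ℕ) :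
    weight t (m + m') = weight t m + weight t m' := by
  simp [weight, add_mul, Finset.sum_add_distrib]

theorem weight_single (t : Fin n → ℝ) (e : Fin n) (k : ℕ) :
    weight t (Pi.single e k) = k * t e := by
  unfold weight
  rw [Finset.sum_eq_single e]
  · simp
  · intro f _ hf
    simp [Pi.single_eq_of_ne hf]
  · simp

theorem mul_le_weight {t : Fin n → ℝ} (ht : ∀ e, 0 < t e) (m : Fin n → ℕ) (e : Fin n) :
    (m e : ℝ) * t e ≤ weight t m :=
  Finset.single_le_sum (f := fun e => (m e : ℝ) * t e)
    (fun e _ => mul_nonneg (Nat.cast_nonneg _) (ht e).le) (Finset.mem_univ e)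

/-- This is where rational independence enters: a time determines the traversal numbers behind it.
-/
theorem weight_injective {t : Fin n → ℝ} (hind : LinearIndependent ℚ t) :
    Function.Injective (weight t) := by
  intro m m' h
  rw [Fintype.linearIndependent_iff] at hind
  have := hind (fun e => (m e : ℚ) - (m' e : ℚ)) (by
    simp only [Rat.smul_def, Rat.cast_sub, Rat.cast_natCast, sub_mul, Finset.sum_sub_distrib]
    exact sub_eq_zero.2 h)
  funext e
  have h1 := sub_eq_zero.1 (this e)
  exact_mod_cast h1

theorem finite_weight_le {t : Fin n → ℝ} (ht : ∀ e, 0 < t e) (T : ℝ) :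
    {m | weight t m ≤ T}.Finite := by
  refine (Set.Finite.pi' (t := fun e => {k : ℕ | k ≤ ⌊T / t e⌋₊})
    fun e => Set.finite_le_nat _).subset ?_
  intro m hm e
  apply Nat.le_floor
  rw [le_div_iff₀ (ht e)]
  exact (mul_le_weight ht m e).trans hm

variable (Γ : SourcedGraph n) {t : Fin n → ℝ}

theorem Emits.exists_weight {v : Γ.V} {s : ℝ} (h : Γ.Emits t v s) : ∃ m, s = weight t m := by
  induction h with
  | start => exact ⟨0, (weight_zero t).symm⟩
  | arrive d s _ ih =>
    obtain ⟨m, rfl⟩ := ih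
    exact ⟨m + Pi.single d.1 1, by rw [weight_add, weight_single]; simp⟩

/-- A point, given by its directed edge and the time it left, at its next departure if it is
reflected at the end of its edge. -/
def bounce (t : Fin n → ℝ) (x : (Fin n × Bool) × ℝ) : (Fin n × Bool) × ℝ :=
  ((x.1.1, !x.1.2), x.2 + t x.1.1)

theorem bounce_injective (t : Fin n → ℝ) : Function.Injective (bounce t) := by
  rintro ⟨⟨e, b⟩, s⟩ ⟨⟨e', b'⟩, s'⟩ h
  simp only [bounce, Prod.mk.injEq] at h
  obtain ⟨⟨rfl, h1⟩, h2⟩ := h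
  have : b = b' := by revert h1; cases b <;> cases b' <;> simp
  simp_all

/-- The departures that do not reflect a point arriving along the same edge. -/
def births (t : Fin n → ℝ) : Set ((Fin n × Bool) × ℝ) :=
  {x | Γ.Emits t (Γ.tail x.1) x.2 ∧ ¬ Γ.Emits t (Γ.head x.1) (x.2 - t x.1.1)}

theorem Emits.reflect {d : Fin n × Bool} {s : ℝ} (h : Γ.Emits t (Γ.tail d) s) :
    Γ.Emits t (Γ.tail (d.1, !d.2)) (s + t d.1) := Emits.arrive d s h

theorem Emits.add_even {d : Fin n × Bool} {s : ℝ} (h : Γ.Emits t (Γ.tail d) s) (j : ℕ) :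
    Γ.Emits t (Γ.tail d) (s + 2 * j * t d.1) := by
  induction j with
  | zero => simpa using h
  | succ j ih =>
    have := (ih.reflect Γ).reflect Γ
    simp only [Bool.not_not] at this
    convert this using 1
    push_cast
    ring

theorem finite_emits (ht : ∀ e, 0 < t e) (T : ℝ) :
    {x : (Fin n × Bool) × ℝ | Γ.Emits t (Γ.tail x.1) x.2 ∧ x.2 ≤ T}.Finite := by
  refine ((Set.finite_univ (α := Fin n × Bool)).prod
    ((finite_weight_le ht T).image (weight t))).subset ?_
  rintro ⟨d, s⟩ ⟨h, hs⟩
  obtain ⟨m, rfl⟩ := h.exists_weight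
  exact ⟨trivial, m, hs, rfl⟩

theorem finite_births (ht : ∀ e, 0 < t e) (T : ℝ) : {x ∈ Γ.births t | x.2 ≤ T}.Finite :=
  (Γ.finite_emits ht T).subset fun _ hx => ⟨hx.1.1, hx.2⟩

/-- The map `f` is a bijection from the elements that stay in `S` onto the elements of `S` that come
from `S`, so both complements have the same size. -/
theorem ncard_diff_image_eq {α : Type*} {S : Set α} (hS : S.Finite) {f : α → α}
    (hf : Function.Injective f) : (S \ f ⁻¹' S).ncard = (S \ f '' S).ncard := by
  have h1 := Set.ncard_inter_add_ncard_sdiff_eq_ncard S (f ⁻¹' S) hS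
  have h2 := Set.ncard_inter_add_ncard_sdiff_eq_ncard S (f '' S) hS
  have h3 : (S ∩ f ⁻¹' S).ncard = (S ∩ f '' S).ncard := by
    rw [← Set.ncard_image_of_injective _ hf, Set.image_inter_preimage, Set.inter_comm]
  omega

/-- Apply `ncard_diff_image_eq` to the departures so far and `bounce`: a point is still moving if
its bounce is not yet among them, and a birth is a departure that is not a bounce. The predicate `P`
covers both `· ≤ T` and `· < T`, that is, both one-sided limits. -/
theorem ncard_points_eq (ht : ∀ e, 0 < t e) (T : ℝ) (P : ℝ → Prop)
    (hP : ∀ s s', s ≤ s' → P s' → P s) (hPT : ∀ s, P s → s ≤ T) :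
    {x : (Fin n × Bool) × ℝ |
      Γ.Emits t (Γ.tail x.1) x.2 ∧ P x.2 ∧ ¬ P (x.2 + t x.1.1)}.ncard =
    {x ∈ Γ.births t | P x.2}.ncard := by
  set S : Set ((Fin n × Bool) × ℝ) := {x | Γ.Emits t (Γ.tail x.1) x.2 ∧ P x.2} with hS
  have hfin : S.Finite := (Γ.finite_emits ht T).subset fun x hx => ⟨hx.1, hPT _ hx.2⟩
  convert ncard_diff_image_eq hfin (bounce_injective t) using 2
  · ext x
    simp only [hS, Set.mem_ofPred_eq, Set.mem_sdiff, Set.mem_preimage, bounce]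
    constructor
    · rintro ⟨h1, h2, h3⟩
      exact ⟨⟨h1, h2⟩, fun h => h3 h.2⟩
    · rintro ⟨⟨h1, h2⟩, h3⟩
      exact ⟨h1, h2, fun h => h3 ⟨h1.reflect Γ, h⟩⟩
  · ext x
    simp only [hS, Set.mem_ofPred_eq, Set.mem_sdiff, Set.mem_image, births]
    constructor
    · rintro ⟨⟨h1, h2⟩, h3⟩
      refine ⟨⟨h1, h3⟩, ?_⟩
      rintro ⟨y, ⟨hy, -⟩, rfl⟩
      apply h2
      simpa [bounce, head, tail] using hy
    · rintro ⟨⟨h1, h2⟩, h3⟩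
      refine ⟨⟨h1, fun h => h3 ?_⟩, h2⟩
      refine ⟨((x.1.1, !x.1.2), x.2 - t x.1.1), ⟨h, ?_⟩, ?_⟩
      · exact hP _ _ (by simpa using (ht _).le) h2
      · simp [bounce]

theorem ncard_pointsAfter (ht : ∀ e, 0 < t e) (T : ℝ) :
    (Γ.pointsAfter t T).ncard = {x ∈ Γ.births t | x.2 ≤ T}.ncard := by
  rw [← Γ.ncard_points_eq ht T (· ≤ T) (fun _ _ => le_trans) (fun _ h => h)]
  simp only [not_le, pointsAfter]

theorem ncard_pointsBefore (ht : ∀ e, 0 < t e) (T : ℝ) :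
    (Γ.pointsBefore t T).ncard = {x ∈ Γ.births t | x.2 < T}.ncard := by
  rw [← Γ.ncard_points_eq ht T (· < T) (fun _ _ => lt_of_le_of_lt) (fun _ h => le_of_lt h)]
  simp only [not_lt, pointsBefore]

/-- Birth times are locally finite, so none lies in a short interval just before `T`; this turns
statements about `≤` into statements about `<`. -/
theorem exists_births_lt_eq (ht : ∀ e, 0 < t e) (T : ℝ) :
    ∃ T₁ < T, ∀ T₂, T₁ ≤ T₂ → T₂ < T →
      {x ∈ Γ.births t | x.2 < T} = {x ∈ Γ.births t | x.2 ≤ T₂} := by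
  have hfin : {x ∈ Γ.births t | x.2 < T}.Finite :=
    (Γ.finite_births ht T).subset fun x hx => ⟨hx.1, hx.2.le⟩
  have : ∃ T₁ < T, ∀ x ∈ {x ∈ Γ.births t | x.2 < T}, x.2 ≤ T₁ := by
    obtain h | h := ({x ∈ Γ.births t | x.2 < T}).eq_empty_or_nonempty
    · exact ⟨T - 1, by linarith, by simp [h]⟩
    · obtain ⟨y, hy, hmax⟩ := Set.exists_max_image _ (fun x => x.2) hfin h
      exact ⟨y.2, hy.2, hmax⟩
  obtain ⟨T₁, h1, h2⟩ := this
  refine ⟨T₁, h1, fun T₂ h3 h4 => Set.ext fun x => ?_⟩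
  exact ⟨fun hx => ⟨hx.1, (h2 x hx).trans h3⟩, fun hx => ⟨hx.1, hx.2.trans_lt h4⟩⟩

theorem N_lt_of_births_lt {Γ Γ' : SourcedGraph n} (ht : ∀ e, 0 < t e) {T₀ : ℝ}
    (h : ∀ T, T₀ ≤ T → {x ∈ Γ'.births t | x.2 ≤ T}.ncard < {x ∈ Γ.births t | x.2 ≤ T}.ncard)
    {T : ℝ} (hT : T₀ < T) : Γ'.N t T < Γ.N t T := by
  have h1 := h T hT.le
  have h2 : {x ∈ Γ'.births t | x.2 < T}.ncard < {x ∈ Γ.births t | x.2 < T}.ncard := by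
    obtain ⟨a, ha, ha'⟩ := Γ.exists_births_lt_eq ht T
    obtain ⟨b, hb, hb'⟩ := Γ'.exists_births_lt_eq ht T
    have hm : max (max a b) T₀ < T := max_lt (max_lt ha hb) hT
    rw [ha' _ ((le_max_left _ _).trans (le_max_left _ _)) hm,
      hb' _ ((le_max_right _ _).trans (le_max_left _ _)) hm]
    exact h _ (le_max_right _ _)
  unfold N
  rw [ncard_pointsAfter _ ht, ncard_pointsAfter _ ht, ncard_pointsBefore _ ht,
    ncard_pointsBefore _ ht]
  have h1' : ({x ∈ Γ'.births t | x.2 ≤ T}.ncard : ℝ) < {x ∈ Γ.births t | x.2 ≤ T}.ncard := by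
    exact_mod_cast h1
  have h2' : ({x ∈ Γ'.births t | x.2 < T}.ncard : ℝ) < {x ∈ Γ.births t | x.2 < T}.ncard := by
    exact_mod_cast h2
  linarith

theorem N_mono (ht : ∀ e, 0 < t e) : Monotone (Γ.N t) := by
  intro T T' hT
  unfold N
  rw [ncard_pointsAfter _ ht, ncard_pointsAfter _ ht, ncard_pointsBefore _ ht,
    ncard_pointsBefore _ ht]
  have h1 : {x ∈ Γ.births t | x.2 ≤ T}.ncard ≤ {x ∈ Γ.births t | x.2 ≤ T'}.ncard :=
    Set.ncard_le_ncard (fun x hx => ⟨hx.1, hx.2.trans hT⟩) (Γ.finite_births ht T')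
  have h2 : {x ∈ Γ.births t | x.2 < T}.ncard ≤ {x ∈ Γ.births t | x.2 < T'}.ncard :=
    Set.ncard_le_ncard (fun x hx => ⟨hx.1, hx.2.trans_le hT⟩)
      ((Γ.finite_births ht T').subset fun x hx => ⟨hx.1, hx.2.le⟩)
  gcongr

theorem N_lt_of_birth (ht : ∀ e, 0 < t e) {T T' : ℝ} (hT : T < T')
    {d : Fin n × Bool} (hd : (d, T') ∈ Γ.births t) : Γ.N t T < Γ.N t T' := by
  unfold N
  rw [ncard_pointsAfter _ ht, ncard_pointsAfter _ ht, ncard_pointsBefore _ ht,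
    ncard_pointsBefore _ ht]
  have h1 : {x ∈ Γ.births t | x.2 ≤ T}.ncard < {x ∈ Γ.births t | x.2 ≤ T'}.ncard := by
    refine Set.ncard_lt_ncard ⟨fun x hx => ⟨hx.1, hx.2.trans hT.le⟩, fun h => ?_⟩
      (Γ.finite_births ht T')
    exact hT.not_ge (h (show (d, T') ∈ _ from ⟨hd, le_rfl⟩)).2
  have h2 : {x ∈ Γ.births t | x.2 < T}.ncard ≤ {x ∈ Γ.births t | x.2 < T'}.ncard :=
    Set.ncard_le_ncard (fun x hx => ⟨hx.1, hx.2.trans hT⟩)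
      ((Γ.finite_births ht T').subset fun x hx => ⟨hx.1, hx.2.le⟩)
  have h1' : ({x ∈ Γ.births t | x.2 ≤ T}.ncard : ℝ) < {x ∈ Γ.births t | x.2 ≤ T'}.ncard := by
    exact_mod_cast h1
  have h2' : ({x ∈ Γ.births t | x.2 < T}.ncard : ℝ) ≤ {x ∈ Γ.births t | x.2 < T'}.ncard := by
    exact_mod_cast h2
  linarith

/-! ### Moving the root along a pendant edge -/

/-- The same graph with another root. -/
def reroot (x : Γ.V) : SourcedGraph n := ⟨Γ.V, x, Γ.endpt⟩

theorem reroot_isWalk (x u v : Γ.V) (p : List (Fin n × Bool)) :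
    (Γ.reroot x).IsWalk u p v ↔ Γ.IsWalk u p v := by
  induction p generalizing u with
  | nil => rfl
  | cons d p ih => exact and_congr Iff.rfl (ih _)

theorem reroot_connected {x : Γ.V} (h : Γ.Connected) : (Γ.reroot x).Connected := fun u v =>
  (h u v).imp fun p hp => (Γ.reroot_isWalk x u v p).2 hp

/-- The first point can leave the new root only along `d₀`. When it reaches the old root, the old
process starts with delay `t d₀.1`. -/
theorem emits_of_reroot_emits {d₀ : Fin n × Bool} (hroot : Γ.head d₀ = Γ.root)
    (hleaf : ∀ d, Γ.tail d = Γ.tail d₀ → d = d₀) {v : (Γ.reroot (Γ.tail d₀)).V} {s : ℝ}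
    (h : (Γ.reroot (Γ.tail d₀)).Emits t v s) :
    Γ.Emits t v (s - t d₀.1) ∨ v = Γ.tail d₀ ∧ s = 0 := by
  induction h with
  | start => exact Or.inr ⟨rfl, rfl⟩
  | arrive d s _ ih =>
    left
    obtain h | ⟨h, rfl⟩ := ih
    · have := Emits.arrive (Γ := Γ) d _ h
      rw [show s + t d.1 - t d₀.1 = s - t d₀.1 + t d.1 by ring]
      exact this
    · obtain rfl := hleaf d h
      have := Emits.start (Γ := Γ) (t := t)
      rw [← hroot] at this
      rw [zero_add, sub_self]
      exact this

theorem Emits.reroot {d₀ : Fin n × Bool} (hroot : Γ.head d₀ = Γ.root) {v : Γ.V} {s : ℝ}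
    (h : Γ.Emits t v s) : (Γ.reroot (Γ.tail d₀)).Emits t v (s + t d₀.1) := by
  induction h with
  | start =>
    have := Emits.arrive (Γ := Γ.reroot (Γ.tail d₀)) (t := t) d₀ 0 Emits.start
    rw [← hroot]
    exact this
  | arrive d s _ ih =>
    have := Emits.arrive (Γ := Γ.reroot (Γ.tail d₀)) (t := t) d _ ih
    rw [add_right_comm]
    exact this

theorem reroot_N {d₀ : Fin n × Bool} (hroot : Γ.head d₀ = Γ.root)
    (hleaf : ∀ d, Γ.tail d = Γ.tail d₀ → d = d₀) {T : ℝ} (hT : t d₀.1 < T) :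
    (Γ.reroot (Γ.tail d₀)).N t T = Γ.N t (T - t d₀.1) := by
  have hinj : Function.Injective
      (fun x : (Fin n × Bool) × ℝ => (x.1, x.2 + t d₀.1)) := by
    rintro ⟨d, s⟩ ⟨d', s'⟩ h
    simpa using h
  have h1 : (Γ.reroot (Γ.tail d₀)).pointsAfter t T =
      (fun x => (x.1, x.2 + t d₀.1)) '' Γ.pointsAfter t (T - t d₀.1) := by
    ext ⟨d, s⟩
    constructor
    · rintro ⟨h, h2, h3⟩
      dsimp only at h2 h3
      obtain h | ⟨h, rfl⟩ := Γ.emits_of_reroot_emits hroot hleaf h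
      · refine ⟨(d, s - t d₀.1), ⟨h, ?_, ?_⟩, by simp⟩ <;> dsimp only <;> linarith
      · obtain rfl := hleaf d h
        linarith
    · rintro ⟨⟨d, s⟩, ⟨h, h2, h3⟩, h4⟩
      obtain ⟨rfl, rfl⟩ := Prod.mk.injEq .. ▸ h4
      dsimp only at h2 h3
      refine ⟨h.reroot Γ hroot, ?_, ?_⟩ <;> dsimp only <;> linarith
  have h2 : (Γ.reroot (Γ.tail d₀)).pointsBefore t T =
      (fun x => (x.1, x.2 + t d₀.1)) '' Γ.pointsBefore t (T - t d₀.1) := by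
    ext ⟨d, s⟩
    constructor
    · rintro ⟨h, h2, h3⟩
      dsimp only at h2 h3
      obtain h | ⟨h, rfl⟩ := Γ.emits_of_reroot_emits hroot hleaf h
      · refine ⟨(d, s - t d₀.1), ⟨h, ?_, ?_⟩, by simp⟩ <;> dsimp only <;> linarith
      · obtain rfl := hleaf d h
        linarith
    · rintro ⟨⟨d, s⟩, ⟨h, h2, h3⟩, h4⟩
      obtain ⟨rfl, rfl⟩ := Prod.mk.injEq .. ▸ h4
      dsimp only at h2 h3
      refine ⟨h.reroot Γ hroot, ?_, ?_⟩ <;> dsimp only <;> linarith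
  unfold N
  rw [h1, h2, Set.ncard_image_of_injective _ hinj, Set.ncard_image_of_injective _ hinj]

/-- Moving the root to the far end of a pendant edge at the root delays everything by the length
of this edge, and hence gives a graph that grows strictly slower, if the root has another edge. -/
theorem reroot_growth (ht : ∀ e, 0 < t e) (hind : LinearIndependent ℚ t)
    {d₀ d₁ : Fin n × Bool} (hroot : Γ.head d₀ = Γ.root)
    (hleaf : ∀ d, Γ.tail d = Γ.tail d₀ → d = d₀) (hd₁ : Γ.tail d₁ = Γ.root)
    (hne : d₁.1 ≠ d₀.1) :
    GrowsNoFaster t (Γ.reroot (Γ.tail d₀)) Γ ∧ ¬ GrowsNoFaster t Γ (Γ.reroot (Γ.tail d₀)) := by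
  constructor
  · filter_upwards [Filter.eventually_gt_atTop (t d₀.1)] with T hT
    rw [Γ.reroot_N hroot hleaf hT]
    exact Γ.N_mono ht (by linarith [ht d₀.1])
  · intro h
    obtain ⟨T₀, hT₀⟩ := Filter.eventually_atTop.1 h
    -- The point that bounces on `d₀` returns to the old root at all even multiples of `t d₀.1`; one
    -- such time is chosen beyond `T₀`.
    obtain ⟨j, hj⟩ := exists_nat_gt (max T₀ 0 / t d₀.1)
    rw [div_lt_iff₀ (ht _)] at hj
    set j' : ℕ := j + 1 with hj'
    have hpos := ht d₀.1
    have hbig : max T₀ 0 + t d₀.1 < 2 * (j' : ℝ) * t d₀.1 := by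
      have := le_max_right T₀ 0
      rw [hj']
      push_cast
      nlinarith
    have h1 := hT₀ (2 * (j' : ℝ) * t d₀.1) (by linarith [le_max_left T₀ 0])
    rw [Γ.reroot_N hroot hleaf (by linarith [le_max_right T₀ 0])] at h1
    refine h1.not_gt (Γ.N_lt_of_birth ht (d := d₁) (by linarith) ⟨?_, ?_⟩)
    · have hs : Γ.Emits t (Γ.tail (d₀.1, !d₀.2)) 0 := by
        have := Emits.start (Γ := Γ) (t := t)
        rwa [← hroot] at this
      have := hs.add_even Γ j'
      simp only [zero_add] at this
      change Γ.Emits t (Γ.tail d₁) _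
      rw [hd₁, ← hroot]
      exact this
    -- A departure along `d₁` at this time is a birth: a time that is a multiple of `t d₀.1` alone
    -- has no traversal of `d₁.1` in it.
    · intro h
      obtain ⟨m, hm⟩ := h.exists_weight
      have h2 : weight t (Pi.single d₀.1 (2 * j')) = weight t (m + Pi.single d₁.1 1) := by
        rw [weight_add, weight_single, weight_single, ← hm]
        push_cast
        ring
      have h3 := congrFun (weight_injective hind h2) d₁.1
      simp [Pi.single_eq_of_ne hne] at h3

end SourcedGraph

/-! ### Rooted trees: departure times and births as integer vectors -/

namespace SourcedGraph

variable {n : ℕ}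

/-- The rooted tree whose vertices are the root `none` and the lower ends `some e` of the edges `e`;
the upper end of `e` is `par e`, and it carries the label `up e`. -/
def treeGraph (par : Fin n → Option (Fin n)) (up : Fin n → Bool) : SourcedGraph n where
  V := Option (Fin n)
  root := none
  endpt e b := if b = up e then par e else some e

/-- `h` increases along each branch of the tree given by `par`. -/
def IsRanked (par : Fin n → Option (Fin n)) (h : Fin n → ℕ) : Prop :=
  ∀ e p, par e = some p → h p < h e

/-- `OnPath par x e`: the edge `e` lies on the path from the root to `x`. -/
inductive OnPath (par : Fin n → Option (Fin n)) : Option (Fin n) → Fin n → Prop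
  | here (e : Fin n) : OnPath par (some e) e
  | above (f e : Fin n) : OnPath par (par f) e → OnPath par (some f) e

section

variable {par : Fin n → Option (Fin n)} {h : Fin n → ℕ}

theorem IsRanked.induction (hr : IsRanked par h) {P : Option (Fin n) → Prop} (h0 : P none)
    (hs : ∀ e, P (par e) → P (some e)) (x : Option (Fin n)) : P x := by
  have key : ∀ k e, h e = k → P (some e) := by
    intro k
    induction k using Nat.strong_induction_on with
    | _ k ih =>
      intro e he
      apply hs
      cases hp : par e with
      | none => exact h0
      | some p => exact ih (h p) (he ▸ hr e p hp) p rfl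
  cases x with
  | none => exact h0
  | some e => exact key _ e rfl

theorem not_onPath_none (e : Fin n) : ¬ OnPath par none e := by
  intro h
  cases h

theorem onPath_some {f e : Fin n} : OnPath par (some f) e ↔ e = f ∨ OnPath par (par f) e := by
  constructor
  · intro h
    cases h with
    | here => exact Or.inl rfl
    | above _ _ h => exact Or.inr h
  · rintro (rfl | h)
    · exact OnPath.here _
    · exact OnPath.above _ _ h

theorem OnPath.trans {x : Option (Fin n)} {e f : Fin n} (h1 : OnPath par x e)
    (h2 : OnPath par (some e) f) : OnPath par x f := by
  induction h1 with
  | here => exact h2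
  | above g e _ ih => exact OnPath.above _ _ (ih h2)

theorem IsRanked.le_of_onPath (hr : IsRanked par h) {e f : Fin n} (hp : OnPath par (some f) e) :
    h e ≤ h f := by
  generalize hx : some f = x at hp
  induction hp generalizing f with
  | here e => simp_all
  | above g e hg ih =>
    obtain rfl := Option.some.inj hx
    cases hpg : par f with
    | none => exact absurd (hpg ▸ hg) (not_onPath_none e)
    | some p => exact (ih hpg.symm).trans (hr f p hpg).le

theorem IsRanked.lt_of_onPath_par (hr : IsRanked par h) {e f : Fin n}
    (hp : OnPath par (par f) e) : h e < h f := by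
  cases hpg : par f with
  | none => exact absurd (hpg ▸ hp) (not_onPath_none e)
  | some p => exact (hr.le_of_onPath (hpg ▸ hp)).trans_lt (hr f p hpg)

theorem IsRanked.not_onPath_par (hr : IsRanked par h) (e : Fin n) : ¬ OnPath par (par e) e :=
  fun hp => (hr.lt_of_onPath_par hp).false

theorem IsRanked.par_ne (hr : IsRanked par h) (e : Fin n) : par e ≠ some e :=
  fun hp => (hr e e hp).false

theorem IsRanked.eq_of_onPath (hr : IsRanked par h) {x y : Option (Fin n)}
    (hxy : ∀ e, OnPath par x e ↔ OnPath par y e) : x = y := by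
  cases x with
  | none =>
    cases y with
    | none => rfl
    | some f => exact absurd ((hxy f).2 (OnPath.here f)) (not_onPath_none f)
  | some e =>
    cases y with
    | none => exact absurd ((hxy e).1 (OnPath.here e)) (not_onPath_none e)
    | some f =>
      rcases onPath_some.1 ((hxy e).1 (OnPath.here e)) with rfl | h1
      · rfl
      · have h2 := hr.lt_of_onPath_par h1
        have h3 := hr.le_of_onPath ((hxy f).2 (OnPath.here f))
        omega

/-- If an edge other than `e` hangs below `e`, then it hangs below a child of `e`. -/
theorem OnPath.exists_child {e f : Fin n} (hp : OnPath par (some f) e) (hne : f ≠ e) :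
    ∃ c, par c = some e ∧ OnPath par (some f) c := by
  generalize hx : some f = x at hp
  induction hp generalizing f with
  | here e => exact absurd (Option.some.inj hx) hne
  | above g e hg ih =>
    obtain rfl := Option.some.inj hx
    cases hpg : par f with
    | none => exact absurd (hpg ▸ hg) (not_onPath_none e)
    | some p =>
      by_cases hpe : p = e
      · exact ⟨f, hpe ▸ hpg, OnPath.here f⟩
      · obtain ⟨c, h1, h2⟩ := ih hpe hpg.symm
        exact ⟨c, h1, OnPath.above _ _ (hpg ▸ h2)⟩

/-- The numbers of traversals of the edges by a walk from the root to `x`: the edges on the path to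
`x` are exactly those traversed an odd number of times, and an edge is traversed only if the one
above it is. -/
def Valid (par : Fin n → Option (Fin n)) (x : Option (Fin n)) (m : Fin n → ℕ) : Prop :=
  (∀ e, Odd (m e) ↔ OnPath par x e) ∧ ∀ e p, par e = some p → 0 < m e → 0 < m p

theorem IsRanked.valid_unique (hr : IsRanked par h) {x y : Option (Fin n)} {m : Fin n → ℕ}
    (hx : Valid par x m) (hy : Valid par y m) : x = y :=
  hr.eq_of_onPath fun e => (hx.1 e).symm.trans (hy.1 e)

theorem odd_add_single {m : Fin n → ℕ} {e f : Fin n} :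
    Odd ((m + Pi.single e 1 : Fin n → ℕ) f) ↔ (Odd (m f) ↔ f ≠ e) := by
  by_cases hf : f = e
  · subst hf
    simp [Nat.odd_add_one]
  · simp [hf]

theorem pos_add_single {m : Fin n → ℕ} {e f : Fin n} :
    0 < (m + Pi.single e 1 : Fin n → ℕ) f ↔ (f = e ∨ 0 < m f) := by
  by_cases hf : f = e
  · subst hf
    simp
  · simp [hf]

theorem IsRanked.valid_down (hr : IsRanked par h) {e : Fin n} {m : Fin n → ℕ}
    (hv : Valid par (par e) m) : Valid par (some e) (m + Pi.single e 1) := by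
  constructor
  · intro f
    rw [odd_add_single, hv.1, onPath_some]
    have := hr.not_onPath_par e
    by_cases hf : f = e
    · subst hf
      simp [this]
    · simp [hf]
  · intro f p hp hf
    rw [pos_add_single] at hf ⊢
    rcases hf with rfl | hf
    · right
      exact ((hv.1 p).2 (hp ▸ OnPath.here p)).pos
    · exact Or.inr (hv.2 f p hp hf)

theorem IsRanked.valid_up (hr : IsRanked par h) {e : Fin n} {m : Fin n → ℕ}
    (hv : Valid par (some e) m) : Valid par (par e) (m + Pi.single e 1) := by
  constructor
  · intro f
    rw [odd_add_single, hv.1, onPath_some]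
    have := hr.not_onPath_par e
    by_cases hf : f = e
    · subst hf
      simp [this]
    · simp [hf]
  · intro f p hp hf
    rw [pos_add_single] at hf ⊢
    rcases hf with rfl | hf
    · right
      exact hv.2 f p hp ((hv.1 f).2 (OnPath.here f)).pos
    · exact Or.inr (hv.2 f p hp hf)

/-- Undoing a descent along `e` must not leave traversed edges below an untraversed `e`; `hc` rules
this out. -/
theorem IsRanked.valid_of_add_single_down (hr : IsRanked par h) {e : Fin n} {m : Fin n → ℕ}
    (hv : Valid par (some e) (m + Pi.single e 1))
    (hc : 0 < m e ∨ ∀ f, par f = some e → m f = 0) : Valid par (par e) m := by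
  constructor
  · intro f
    have h1 := hv.1 f
    rw [odd_add_single, onPath_some] at h1
    have := hr.not_onPath_par e
    by_cases hf : f = e
    · subst hf
      simp_all
    · simp_all
  · intro f p hp hf
    have h1 := hv.2 f p hp (pos_add_single.2 (Or.inr hf))
    rw [pos_add_single] at h1
    rcases h1 with rfl | h1
    · rcases hc with hc | hc
      · exact hc
      · exact absurd (hc f hp) hf.ne'
    · exact h1

theorem IsRanked.valid_of_add_single_up (hr : IsRanked par h) {e : Fin n} {m : Fin n → ℕ}
    (hv : Valid par (par e) (m + Pi.single e 1)) : Valid par (some e) m := by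
  have hodd : ∀ f, Odd (m f) ↔ OnPath par (some e) f := by
    intro f
    have h1 := hv.1 f
    rw [odd_add_single] at h1
    rw [onPath_some]
    have := hr.not_onPath_par e
    by_cases hf : f = e
    · subst hf
      simp_all
    · simp_all
  refine ⟨hodd, fun f p hp hf => ?_⟩
  have h1 := hv.2 f p hp (pos_add_single.2 (Or.inr hf))
  rw [pos_add_single] at h1
  rcases h1 with rfl | h1
  · exact ((hodd _).2 (OnPath.here _)).pos
  · exact h1

theorem exists_eq_add_single {m : Fin n → ℕ} {e : Fin n} (he : 0 < m e) :
    ∃ m' : Fin n → ℕ, m = m' + Pi.single e 1 ∧ m' e + 1 = m e := by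
  refine ⟨m - Pi.single e 1, ?_, ?_⟩
  · funext f
    by_cases hf : f = e
    · subst hf
      simp
      omega
    · simp [Pi.single_eq_of_ne hf]
  · simp
    omega

variable (up : Fin n → Bool) {t : Fin n → ℝ}

theorem treeGraph_tail (d : Fin n × Bool) :
    (treeGraph par up).tail d = if d.2 = up d.1 then par d.1 else some d.1 := rfl

theorem treeGraph_head (d : Fin n × Bool) :
    (treeGraph par up).head d = if d.2 = up d.1 then some d.1 else par d.1 := by
  obtain ⟨e, b⟩ := d
  change (if (!b) = up e then par e else some e) = _
  by_cases hb : b = up e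
  · subst hb
    simp
  · simp only [hb, if_false]
    rw [if_pos]
    revert hb
    cases b <;> cases up e <;> simp

theorem treeGraph_tail_up (e : Fin n) : (treeGraph par up).tail (e, up e) = par e :=
  (treeGraph_tail up _).trans (if_pos rfl)

theorem treeGraph_tail_not_up (e : Fin n) : (treeGraph par up).tail (e, !up e) = some e :=
  (treeGraph_tail up _).trans (if_neg (by simp))

theorem treeGraph_head_up (e : Fin n) : (treeGraph par up).head (e, up e) = some e :=
  (treeGraph_head up _).trans (if_pos rfl)

theorem treeGraph_head_not_up (e : Fin n) : (treeGraph par up).head (e, !up e) = par e :=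
  (treeGraph_head up _).trans (if_neg (by simp))

theorem IsRanked.valid_of_emits (hr : IsRanked par h) {x : (treeGraph par up).V} {s : ℝ}
    (hs : (treeGraph par up).Emits t x s) : ∃ m, Valid par x m ∧ s = weight t m := by
  induction hs with
  | start =>
    refine ⟨0, ⟨fun e => ?_, fun e p _ he => ?_⟩, (weight_zero t).symm⟩
    · exact iff_of_false (by simp) (not_onPath_none e)
    · simp at he
  | arrive d s _ ih =>
    obtain ⟨m, hm, rfl⟩ := ih
    refine ⟨m + Pi.single d.1 1, ?_, by rw [weight_add, weight_single]; simp⟩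
    rw [treeGraph_tail] at hm
    rw [treeGraph_head]
    split_ifs at hm ⊢
    · exact hr.valid_down hm
    · exact hr.valid_up hm

theorem emits_down {e : Fin n} {s : ℝ} (hs : (treeGraph par up).Emits t (par e) s) :
    (treeGraph par up).Emits t (some e) (s + t e) := by
  have := Emits.arrive (Γ := treeGraph par up) (t := t) (e, up e) s
    (by rw [treeGraph_tail]; simpa using hs)
  rw [treeGraph_head] at this
  simpa using this

theorem emits_up {e : Fin n} {s : ℝ} (hs : (treeGraph par up).Emits t (some e) s) :
    (treeGraph par up).Emits t (par e) (s + t e) := by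
  have := Emits.arrive (Γ := treeGraph par up) (t := t) (e, !up e) s
    (by rw [treeGraph_tail]; simpa using hs)
  rw [treeGraph_head] at this
  simpa using this

/-- A walk with the prescribed traversal numbers is built backwards, by induction on their sum,
removing one last step at a time. -/
theorem IsRanked.emits_of_valid (hr : IsRanked par h) {x : Option (Fin n)} {m : Fin n → ℕ}
    (hv : Valid par x m) : (treeGraph par up).Emits t x (weight t m) := by
  obtain ⟨k, hk⟩ : ∃ k, ∑ e, m e = k := ⟨_, rfl⟩
  induction k generalizing x m with
  | zero =>
    obtain rfl : m = 0 := by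
      funext e
      exact (Finset.sum_eq_zero_iff.1 hk) e (Finset.mem_univ e)
    cases x with
    | none => rw [weight_zero]; exact Emits.start
    | some e => simpa using (hv.1 e).2 (OnPath.here e)
  | succ k ih =>
    have hsum : ∀ (e : Fin n) (m' : Fin n → ℕ), m = m' + Pi.single e 1 → ∑ e, m' e = k := by
      rintro e m' rfl
      simpa [Finset.sum_add_distrib] using hk
    -- If an edge below `x` has been traversed, the last step can be taken to come up along it.
    -- Otherwise nothing below `x` is used and the last step comes down to `x`.
    by_cases hc : ∃ f, par f = x ∧ 0 < m f
    · obtain ⟨f, rfl, hf⟩ := hc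
      obtain ⟨m', rfl, -⟩ := exists_eq_add_single hf
      have := emits_up up (ih (hr.valid_of_add_single_up hv) (hsum f m' rfl))
      rw [weight_add, weight_single]
      simpa using this
    · push Not at hc
      cases x with
      | none =>
        exfalso
        have h0 : ∀ x : Option (Fin n), ∀ e, x = some e → m e = 0 := by
          refine hr.induction (P := fun x => ∀ e, x = some e → m e = 0) ?_ ?_
          · simp
          · intro e ih e' he'
            obtain rfl := Option.some.inj he'
            cases hp : par e with
            | none => exact Nat.le_zero.1 (hc e hp)
            | some p =>
              by_contra hne
              exact (hv.2 e p hp (Nat.pos_of_ne_zero hne)).ne' (ih p hp)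
        rw [Finset.sum_eq_zero fun e _ => h0 _ e rfl] at hk
        omega
      | some e =>
        obtain ⟨m', rfl, -⟩ := exists_eq_add_single ((hv.1 e).2 (OnPath.here e)).pos
        have hz : ∀ f, par f = some e → m' f = 0 := by
          intro f hf
          have := hc f hf
          simp only [Pi.add_apply] at this
          omega
        have := emits_down up (ih (hr.valid_of_add_single_down hv (Or.inr hz)) (hsum e m' rfl))
        rw [weight_add, weight_single]
        simpa using this

theorem IsRanked.emits_weight_iff (hr : IsRanked par h) (hind : LinearIndependent ℚ t)
    {x : Option (Fin n)} {m : Fin n → ℕ} :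
    (treeGraph par up).Emits t x (weight t m) ↔ Valid par x m := by
  constructor
  · intro hs
    obtain ⟨m', hm', h1⟩ := hr.valid_of_emits up hs
    rwa [weight_injective hind h1]
  · exact hr.emits_of_valid up

/-- The births in a tree. The triple `(e, false, m)` stands for a first departure along `e` away
from the root, `(e, true, m)` for a first departure towards the root; `m` counts the traversals. -/
def treeBirths (par : Fin n → Option (Fin n)) : Set (Fin n × Bool × (Fin n → ℕ)) :=
  {x | (x.2.1 = false ∧ Valid par (par x.1) x.2.2 ∧ x.2.2 x.1 = 0) ∨
    (x.2.1 = true ∧ Valid par (some x.1) x.2.2 ∧ x.2.2 x.1 = 1 ∧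
      ∃ f, par f = some x.1 ∧ 0 < x.2.2 f)}

theorem finite_treeBirths (par : Fin n → Option (Fin n)) (ht : ∀ e, 0 < t e) (T : ℝ) :
    {x ∈ treeBirths par | weight t x.2.2 ≤ T}.Finite := by
  refine ((Set.finite_univ (α := Fin n)).prod ((Set.finite_univ (α := Bool)).prod
    (finite_weight_le ht T))).subset ?_
  rintro ⟨e, k, m⟩ hx
  exact ⟨trivial, trivial, hx.2⟩

/-- A departure is not a birth exactly when one traversal of `e` can be removed, leaving a valid
vector at the other end. Going down, this fails only if `e` is unused. Going up, it fails only if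
`e` was used once and some edge below it is already used. The `xor` translates "towards the root"
into the arbitrary labelling `up`. -/
theorem IsRanked.mem_births_iff (hr : IsRanked par h) (hind : LinearIndependent ℚ t)
    (e : Fin n) (k : Bool) (m : Fin n → ℕ) :
    ((e, xor k (up e)), weight t m) ∈ (treeGraph par up).births t ↔ (e, k, m) ∈ treeBirths par := by
  simp only [births, Set.mem_ofPred_eq, treeBirths, treeGraph_head, treeGraph_tail]
  have hsub : ∀ m', weight t (m' + Pi.single e 1) - t e = weight t m' := by
    intro m'
    rw [weight_add, weight_single]
    simp
  have hzero : m e = 0 → ∀ y, ¬ (treeGraph par up).Emits t y (weight t m - t e) := by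
    intro h0 y hy
    obtain ⟨m', -, h1⟩ := hr.valid_of_emits up hy
    have h2 : weight t m = weight t (m' + Pi.single e 1) := by
      linarith [hsub m']
    have := congrFun (weight_injective hind h2) e
    simp at this
    omega
  cases k with
  | false =>
    simp only [Bool.false_xor, if_true, true_and, Bool.false_eq_true, false_and, or_false]
    rw [hr.emits_weight_iff up hind]
    refine and_congr_right fun hv => ⟨fun hn => ?_, fun h0 => hzero h0 _⟩
    by_contra hne
    obtain ⟨m', rfl, -⟩ := exists_eq_add_single (Nat.pos_of_ne_zero hne)
    rw [hsub, hr.emits_weight_iff up hind] at hn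
    exact hn (hr.valid_of_add_single_up hv)
  | true =>
    simp only [Bool.true_xor, Bool.not_eq_eq_eq_not, Bool.eq_not_self, if_false, Bool.true_eq_false,
      false_and, true_and, false_or]
    rw [hr.emits_weight_iff up hind]
    refine and_congr_right fun hv => ?_
    have hodd := (hv.1 e).2 (OnPath.here e)
    obtain ⟨m', rfl, he⟩ := exists_eq_add_single hodd.pos
    rw [hsub, hr.emits_weight_iff up hind]
    have hne : ∀ f, par f = some e → f ≠ e := by
      rintro f hf rfl
      exact hr.par_ne f hf
    constructor
    · intro hn
      refine ⟨?_, ?_⟩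
      · by_contra h1
        exact hn (hr.valid_of_add_single_down hv (Or.inl (by omega)))
      · by_contra! h1
        refine hn (hr.valid_of_add_single_down hv (Or.inr fun f hf => ?_))
        have := h1 f hf
        simp only [Pi.add_apply] at this
        omega
    · rintro ⟨h1, f, hf, hf'⟩ hn
      have h2 := hn.2 f e hf
      simp only [Pi.add_apply, Pi.single_eq_of_ne (hne f hf)] at hf'
      omega

theorem IsRanked.ncard_births (hr : IsRanked par h) (hind : LinearIndependent ℚ t) (T : ℝ) :
    {x ∈ (treeGraph par up).births t | x.2 ≤ T}.ncard =
      {x ∈ treeBirths par | weight t x.2.2 ≤ T}.ncard := by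
  have hinj : Function.Injective (fun x : Fin n × Bool × (Fin n → ℕ) =>
      (((x.1, xor x.2.1 (up x.1)), weight t x.2.2) : (Fin n × Bool) × ℝ)) := by
    rintro ⟨e, k, m⟩ ⟨e', k', m'⟩ h
    simp only [Prod.mk.injEq] at h
    obtain ⟨⟨rfl, h1⟩, h2⟩ := h
    rw [weight_injective hind h2, Bool.xor_left_inj.1 h1]
  rw [← Set.ncard_image_of_injective _ hinj]
  congr 1
  ext ⟨⟨e, b⟩, s⟩
  constructor
  · rintro ⟨h1, h2⟩
    obtain ⟨m, rfl⟩ := h1.1.exists_weight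
    refine ⟨(e, xor b (up e), m), ⟨?_, h2⟩, by simp⟩
    rw [← hr.mem_births_iff up hind]
    simpa using h1
  · rintro ⟨⟨e, k, m⟩, ⟨h1, h2⟩, h3⟩
    rw [← h3]
    exact ⟨(hr.mem_births_iff up hind e k m).2 h1, h2⟩

end

end SourcedGraph

/-! ### Dense combinations and counting in boxes -/

namespace SourcedGraph

variable {n : ℕ}

/-- Sums of nonnegative multiples of two rationally independent numbers meet every window of fixed
width that is far enough. -/
theorem exists_nat_combination_mem_Ioc {α β w : ℝ} (hα : 0 < α)
    (hirr : Irrational (α / β)) (hw : 0 < w) :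
    ∃ X₀ : ℝ, ∀ X, X₀ ≤ X → ∃ i j : ℕ, (i : ℝ) * α + j * β ∈ Set.Ioc X (X + w) := by
  have hdense : Dense (AddSubgroup.closure {α, β} : Set ℝ) :=
    dense_addSubgroupClosure_pair_iff.2 hirr
  obtain ⟨δ, hδ, hδ0, hδw⟩ : ∃ δ ∈ AddSubgroup.closure {α, β}, 0 < δ ∧ δ < w := by
    obtain ⟨δ, h1, h2⟩ := hdense.exists_mem_open isOpen_Ioo (Set.nonempty_Ioo.2 hw)
    exact ⟨δ, h1, h2⟩
  obtain ⟨p, q, rfl⟩ := AddSubgroup.mem_closure_pair.1 hδ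
  simp only [zsmul_eq_mul] at hδ0 hδw
  set δ : ℝ := p * α + q * β with hδdef
  set K : ℕ := ⌊α / δ⌋₊ + 1 with hK
  -- The threshold is a reserve of `α` and `β` that keeps the coefficients nonnegative after adding
  -- up to `K` copies of `δ`, whose coefficients `p`, `q` may be negative.
  refine ⟨K * p.natAbs * α + K * q.natAbs * β, fun X hX => ?_⟩
  set Y : ℝ := X - (K * p.natAbs * α + K * q.natAbs * β) with hY
  have hY0 : 0 ≤ Y := sub_nonneg.2 hX
  -- Steps of length `α` reach the last point at or below `X`; then steps of length `δ < w` cannot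
  -- jump over the window.
  set i : ℕ := ⌊Y / α⌋₊ with hi
  have hi1 : (i : ℝ) * α ≤ Y := (le_div_iff₀ hα).1 (Nat.floor_le (by positivity))
  have hi2 : Y < (i + 1) * α := (div_lt_iff₀ hα).1 (Nat.lt_floor_add_one _)
  set r : ℝ := Y - i * α with hr
  have hr0 : 0 ≤ r := sub_nonneg.2 hi1
  set l : ℕ := ⌊r / δ⌋₊ + 1 with hl
  have hl1 : r < l * δ := by
    rw [hl]
    push_cast
    exact (div_lt_iff₀ hδ0).1 (Nat.lt_floor_add_one _)
  have hl2 : (l : ℝ) * δ ≤ r + δ := by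
    have : (⌊r / δ⌋₊ : ℝ) * δ ≤ r := (le_div_iff₀ hδ0).1 (Nat.floor_le (by positivity))
    rw [hl]
    push_cast
    linarith
  have hlK : l ≤ K := by
    apply Nat.succ_le_succ
    apply Nat.floor_mono
    gcongr
    linarith
  have hnn : ∀ z : ℤ, 0 ≤ (K : ℤ) * z.natAbs + l * z := by
    intro z
    have h1 : -(z.natAbs : ℤ) ≤ z := by omega
    have h2 : (l : ℤ) ≤ K := by exact_mod_cast hlK
    have h3 : (0 : ℤ) ≤ z.natAbs := by omega
    have h4 : (0 : ℤ) ≤ l := by omega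
    nlinarith
  obtain ⟨a, ha⟩ := Int.eq_ofNat_of_zero_le (hnn p)
  obtain ⟨b, hb⟩ := Int.eq_ofNat_of_zero_le (hnn q)
  have ha' : (a : ℝ) = K * p.natAbs + l * p := by
    have := congrArg (Int.cast : ℤ → ℝ) ha
    simp only [Int.cast_add, Int.cast_mul, Int.cast_natCast] at this
    exact this.symm
  have hb' : (b : ℝ) = K * q.natAbs + l * q := by
    have := congrArg (Int.cast : ℤ → ℝ) hb
    simp only [Int.cast_add, Int.cast_mul, Int.cast_natCast] at this
    exact this.symm
  refine ⟨i + a, b, ?_⟩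
  have hval : ((i + a : ℕ) : ℝ) * α + b * β = X - r + l * δ := by
    push_cast
    rw [ha', hb', hr, hY, hδdef]
    ring
  rw [hval]
  constructor <;> linarith

theorem exists_nat_combinations_mem_Ioc {α β w : ℝ} (hα : 0 < α)
    (hirr : Irrational (α / β)) (hw : 0 < w) (M : ℕ) :
    ∃ X₀ : ℝ, ∀ X, X₀ ≤ X → ∃ f : Fin M → ℕ × ℕ, Function.Injective f ∧
      ∀ l, ((f l).1 : ℝ) * α + (f l).2 * β ∈ Set.Ioc X (X + w) := by
  rcases Nat.eq_zero_or_pos M with rfl | hM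
  · exact ⟨0, fun X _ => ⟨fun l => l.elim0, fun l => l.elim0, fun l => l.elim0⟩⟩
  have hM' : (0 : ℝ) < M := by exact_mod_cast hM
  obtain ⟨X₀, hX₀⟩ := exists_nat_combination_mem_Ioc hα hirr (div_pos hw hM')
  refine ⟨X₀, fun X hX => ?_⟩
  -- Cut the window into `M` disjoint pieces of width `w / M` and find one combination in each.
  have key : ∀ l : Fin M, ∃ f : ℕ × ℕ, (f.1 : ℝ) * α + f.2 * β ∈
      Set.Ioc (X + l * (w / M)) (X + (l + 1) * (w / M)) := by
    intro l
    have : 0 ≤ (l : ℝ) * (w / M) := by positivity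
    obtain ⟨i, j, hij⟩ := hX₀ (X + l * (w / M)) (by linarith)
    refine ⟨(i, j), ?_⟩
    convert hij using 2
    ring
  choose f hf using key
  have hwM : 0 < w / M := div_pos hw hM'
  refine ⟨f, ?_, fun l => ?_⟩
  · have hmono : ∀ l l' : Fin M, f l = f l' → ¬ l < l' := by
      intro l l' h hlt
      have h1 := (hf l).2
      rw [h] at h1
      have h2 := (hf l').1
      have h3 : (l : ℝ) + 1 ≤ l' := by exact_mod_cast hlt
      nlinarith
    intro l l' h
    exact le_antisymm (not_lt.1 (hmono _ _ h.symm)) (not_lt.1 (hmono _ _ h))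
  · have h1 := (hf l).1
    have h2 := (hf l).2
    have h3 : 0 ≤ (l : ℝ) * (w / M) := by positivity
    have h4 : (l : ℝ) + 1 ≤ M := by exact_mod_cast l.2
    have h5 : ((l : ℝ) + 1) * (w / M) ≤ M * (w / M) := by gcongr
    rw [mul_div_cancel₀ _ hM'.ne'] at h5
    exact ⟨by linarith, by linarith⟩

theorem irrational_div_of_linearIndependent {t : Fin n → ℝ} (ht : ∀ e, 0 < t e)
    (hind : LinearIndependent ℚ t) {g c : Fin n} (hgc : g ≠ c) : Irrational (t g / t c) := by
  rintro ⟨r, hr⟩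
  rw [Fintype.linearIndependent_iff] at hind
  have h1 := hind (Pi.single g 1 + Pi.single c (-r)) (by
    simp only [Pi.add_apply, add_smul, Finset.sum_add_distrib]
    rw [Finset.sum_eq_single g (fun f _ hf => by simp [Pi.single_eq_of_ne hf]) (by simp),
      Finset.sum_eq_single c (fun f _ hf => by simp [Pi.single_eq_of_ne hf]) (by simp)]
    simp only [Pi.single_eq_same, one_smul, Rat.smul_def, Rat.cast_neg, hr]
    have := (ht c).ne'
    field_simp
    ring) g
  simp [Pi.single_eq_of_ne hgc] at h1

/-- The vectors that vanish at `g` and `c`, are less than `Q` at `e` and at most `K` elsewhere. -/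
def box (g c e : Fin n) (Q K : ℕ) : Finset (Fin n → ℕ) :=
  Fintype.piFinset fun f =>
    if f = g ∨ f = c then {0} else if f = e then Finset.range Q else Finset.range (K + 1)

theorem mem_box {g c e : Fin n} {Q K : ℕ} (heg : e ≠ g) (hec : e ≠ c) {m : Fin n → ℕ} :
    m ∈ box g c e Q K ↔ m g = 0 ∧ m c = 0 ∧ m e < Q ∧
      ∀ f, f ≠ g → f ≠ c → f ≠ e → m f ≤ K := by
  rw [box, Fintype.mem_piFinset]
  constructor
  · intro h
    refine ⟨by simpa using h g, by simpa using h c, by simpa [heg, hec] using h e, ?_⟩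
    intro f h1 h2 h3
    have := h f
    simp [h1, h2, h3] at this
    omega
  · rintro ⟨h1, h2, h3, h4⟩ f
    split_ifs with hf hf'
    · rcases hf with rfl | rfl <;> simpa
    · subst hf'
      simpa using h3
    · push Not at hf
      have := h4 f hf.1 hf.2 hf'
      simp
      omega

theorem card_box {g c e : Fin n} (hgc : g ≠ c) (heg : e ≠ g) (hec : e ≠ c) (Q K : ℕ) :
    (box g c e Q K).card = Q * (K + 1) ^ (n - 3) := by
  rw [box, Fintype.card_piFinset]
  have h3 : ({g, c, e} : Finset (Fin n)).card = 3 := by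
    rw [Finset.card_eq_three]
    exact ⟨g, c, e, hgc, heg.symm, hec.symm, rfl⟩
  rw [← Finset.prod_mul_prod_compl ({g, c, e} : Finset (Fin n))]
  congr 1
  · rw [Finset.prod_insert, Finset.prod_pair hec.symm]
    · simp [heg, hec]
    · simp [hgc, heg.symm]
  · rw [Finset.prod_congr rfl (g := fun _ => K + 1), Finset.prod_const, Finset.card_compl, h3,
      Fintype.card_fin]
    intro f hf
    simp only [Finset.mem_compl, Finset.mem_insert, Finset.mem_singleton, not_or] at hf
    simp [hf]

end SourcedGraph

/-! ### Lifting a branch: the injection on births -/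

namespace SourcedGraph

variable {n : ℕ}

/-- The tree in which the branch starting with the edge `b` is moved to the upper end of `g`. -/
def liftBranch (par : Fin n → Option (Fin n)) (b g : Fin n) : Fin n → Option (Fin n) :=
  Function.update par b (par g)

variable {par : Fin n → Option (Fin n)} {h : Fin n → ℕ} {b c g : Fin n}

theorem liftBranch_self : liftBranch par b g b = par g := Function.update_self ..

theorem liftBranch_of_ne {f : Fin n} (hf : f ≠ b) : liftBranch par b g f = par f :=
  Function.update_of_ne hf ..

theorem IsRanked.liftBranch (hr : IsRanked par h) (hb : par b = some g) :
    IsRanked (liftBranch par b g) h := by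
  intro e p hp
  by_cases he : e = b
  · subst he
    rw [liftBranch_self] at hp
    exact (hr g p hp).trans (hr e g hb)
  · rw [liftBranch_of_ne he] at hp
    exact hr e p hp

theorem IsRanked.not_onPath_of_par_eq (hr : IsRanked par h) (hb : par b = some g) :
    ¬ OnPath par (some g) b :=
  fun hp => hr.not_onPath_par b (hb ▸ hp)

/-- Lifting removes `g` from the paths to vertices of the branch of `b` and changes no other path.
-/
theorem IsRanked.onPath_liftBranch (hr : IsRanked par h) (hb : par b = some g)
    (x : Option (Fin n)) :
    ∀ e, OnPath (SourcedGraph.liftBranch par b g) x e ↔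
      OnPath par x e ∧ (OnPath par x b → e ≠ g) := by
  have hgb : g ≠ b := by
    rintro rfl
    exact hr.par_ne g hb
  have hng := hr.not_onPath_of_par_eq hb
  refine hr.induction (P := fun x => ∀ e, OnPath (SourcedGraph.liftBranch par b g) x e ↔
      OnPath par x e ∧ (OnPath par x b → e ≠ g)) ?_ ?_ x
  · intro e
    simp [not_onPath_none]
  · intro f ih e
    by_cases hf : f = b
    · subst hf
      have ih' := ih e
      rw [hb] at ih'
      simp only [hng, false_imp_iff, and_true] at ih'
      rw [onPath_some, onPath_some, liftBranch_of_ne hgb] at ih'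
      rw [onPath_some, onPath_some, liftBranch_self, hb, onPath_some]
      have h1 := (hr.liftBranch hb).not_onPath_par g
      rw [liftBranch_of_ne hgb] at h1
      have h2 := hr.not_onPath_par g
      have h3 : OnPath par (some f) f := OnPath.here f
      by_cases heg : e = g
      · subst heg
        simp [h1, hgb, h3]
      · simp only [heg, false_or] at ih'
        simp [ih', heg]
    · rw [onPath_some, liftBranch_of_ne hf, ih, onPath_some, onPath_some]
      have hfg : f = g → ¬ OnPath par (par f) b := by
        rintro rfl hp
        exact hng (OnPath.above _ _ hp)
      by_cases hef : e = f
      · subst hef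
        simp only [true_or, true_and, true_iff]
        rintro (h1 | h1) rfl
        · exact hf h1.symm
        · exact hfg rfl h1
      · simp [hef, Ne.symm hf]

theorem IsRanked.valid_of_liftBranch (hr : IsRanked par h) (hb : par b = some g)
    {x : Option (Fin n)} {m : Fin n → ℕ} (hv : Valid (SourcedGraph.liftBranch par b g) x m)
    (hx : ¬ OnPath par x b) (hm : 0 < m b → 0 < m g) : Valid par x m := by
  refine ⟨fun e => ?_, fun e p hp he => ?_⟩
  · rw [hv.1, hr.onPath_liftBranch hb]
    simp [hx]
  · by_cases heb : e = b
    · subst heb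
      obtain rfl := Option.some.inj (hb.symm.trans hp)
      exact hm he
    · exact hv.2 e p (by rwa [liftBranch_of_ne heb]) he

theorem IsRanked.valid_of_liftBranch_add_single (hr : IsRanked par h) (hb : par b = some g)
    {x : Option (Fin n)} {m : Fin n → ℕ}
    (hv : Valid (SourcedGraph.liftBranch par b g) x (m + Pi.single g 1))
    (hx : OnPath par x b) (hm : 0 < m g) : Valid par x m := by
  have hxg : OnPath par x g := hx.trans (OnPath.above _ _ (hb ▸ OnPath.here g))
  refine ⟨fun e => ?_, fun e p hp he => ?_⟩
  · have h1 := hv.1 e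
    rw [odd_add_single, hr.onPath_liftBranch hb] at h1
    by_cases heg : e = g
    · subst heg
      simp_all
    · simp_all
  · by_cases heb : e = b
    · subst heb
      obtain rfl := Option.some.inj (hb.symm.trans hp)
      exact hm
    · have := hv.2 e p (by rwa [liftBranch_of_ne heb]) (pos_add_single.2 (Or.inr he))
      rcases pos_add_single.1 this with rfl | h1
      · exact hm
      · exact h1

/-- A map from the births of the tree with a lifted branch to those of the original tree. -/
noncomputable def lowerBirth (par : Fin n → Option (Fin n)) (b g : Fin n)
    (x : Fin n × Bool × (Fin n → ℕ)) : Fin n × Bool × (Fin n → ℕ) :=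
  open Classical in
  if OnPath par (some x.1) b then (x.1, x.2.1, x.2.2 - Pi.single g 1)
  else if x.1 = g ∧ x.2.1 = false ∧ 0 < x.2.2 b then (g, true, x.2.2 + Pi.single g 1)
  else x

/-- The births that need not correspond to births of the original tree. -/
def IsStray (g c : Fin n) (x : Fin n × Bool × (Fin n → ℕ)) : Prop :=
  x.1 ≠ g ∧ x.1 ≠ c ∧ x.2.2 g = 0 ∧ x.2.2 c = 0 ∧ x.2.2 x.1 < 2

theorem lowerBirth_fst (x : Fin n × Bool × (Fin n → ℕ)) : (lowerBirth par b g x).1 = x.1 := by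
  unfold lowerBirth
  split_ifs with h1 h2
  · rfl
  · exact h2.1.symm
  · rfl

theorem lt_two_of_mem_treeBirths {x : Fin n × Bool × (Fin n → ℕ)} (hx : x ∈ treeBirths par) :
    x.2.2 x.1 < 2 := by
  rcases hx with ⟨-, -, h⟩ | ⟨-, -, h, -⟩ <;> omega

theorem zero_of_liftBranch (hc : par c = some g) (hbc : b ≠ c) {y : Option (Fin n)} {m : Fin n → ℕ}
    (hv : Valid (liftBranch par b g) y m) (hg : m g = 0) : m c = 0 := by
  by_contra h0
  exact (hv.2 c g (by rwa [liftBranch_of_ne hbc.symm]) (Nat.pos_of_ne_zero h0)).ne' hg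

/-- This makes the truncated subtraction in `lowerBirth` a genuine one. -/
theorem pos_of_not_isStray (hr : IsRanked par h) (hb : par b = some g) (hc : par c = some g)
    (hbc : b ≠ c) {x : Fin n × Bool × (Fin n → ℕ)}
    (hx : x ∈ treeBirths (liftBranch par b g)) (hns : ¬ IsStray g c x)
    (hxb : OnPath par (some x.1) b) : 0 < x.2.2 g := by
  have hgb := hr.not_onPath_of_par_eq hb
  have hcb : ¬ OnPath par (some c) b := by
    rw [onPath_some, hc]
    tauto
  by_contra h0
  have h0' : x.2.2 g = 0 := by omega
  refine hns ⟨?_, ?_, h0', ?_, lt_two_of_mem_treeBirths hx⟩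
  · intro he
    exact hgb (he ▸ hxb)
  · intro he
    exact hcb (he ▸ hxb)
  · rcases hx with ⟨-, hv, -⟩ | ⟨-, hv, -⟩ <;> exact zero_of_liftBranch hc hbc hv h0'

/-- Inside the branch the parity at `g` has to change, whence the removed traversal. Outside it, the
only obstacle is a vector that uses `b` but not `g`. For such a vector a birth is stray, except for
the first descent along `g`, which is replaced by the first ascent along `g`, prompted in the old
tree by the used edge `b`. -/
theorem lowerBirth_mem (hr : IsRanked par h) (hb : par b = some g) (hc : par c = some g)
    (hbc : b ≠ c) {x : Fin n × Bool × (Fin n → ℕ)}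
    (hx : x ∈ treeBirths (liftBranch par b g)) (hns : ¬ IsStray g c x) :
    lowerBirth par b g x ∈ treeBirths par := by
  obtain ⟨e, k, m⟩ := x
  have hgb := hr.not_onPath_of_par_eq hb
  have hgb' : g ≠ b := by
    rintro rfl
    exact hr.par_ne g hb
  have hgb'' : ¬ OnPath par (par g) b := fun h => hgb (OnPath.above _ _ h)
  by_cases heb : OnPath par (some e) b
  · have hpos := pos_of_not_isStray hr hb hc hbc hx hns heb
    simp only at hpos
    have heg : e ≠ g := by
      rintro rfl
      exact hgb heb
    obtain ⟨m, rfl, hm⟩ := exists_eq_add_single hpos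
    have hlow : lowerBirth par b g (e, k, m + Pi.single g 1) = (e, k, m) := by
      unfold lowerBirth
      rw [if_pos heb, add_tsub_cancel_right]
    rw [hlow]
    have hme : (m + Pi.single g 1 : Fin n → ℕ) e = m e := by simp [Pi.single_eq_of_ne heg]
    -- In the lifted tree the number of traversals of `g` is even and positive here, hence at least
    -- 2, so one remains after the removal.
    have heven : ∀ {y}, Valid (liftBranch par b g) y (m + Pi.single g 1) →
        ¬ OnPath (liftBranch par b g) y g → 0 < m g := by
      intro y hv hy
      have h1 := (hv.1 g).not.2 hy
      rw [odd_add_single] at h1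
      by_contra h0
      have : m g = 0 := by omega
      simp [this] at h1
    rcases hx with ⟨hk, hv, h0⟩ | ⟨hk, hv, h1, f, hf, hf0⟩
    · simp only at hk hv h0
      refine Or.inl ⟨hk, ?_, hme.symm.trans h0⟩
      by_cases he : e = b
      · subst he
        rw [liftBranch_self] at hv
        have hmg : 0 < m g := heven hv (by
          rw [hr.onPath_liftBranch hb]
          exact fun h => hr.not_onPath_par g h.1)
        have := hr.valid_of_liftBranch hb hv hgb'' (fun _ => by simp)
        simp only [hb]
        exact hr.valid_of_add_single_up this
      · rw [liftBranch_of_ne he] at hv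
        have hpb : OnPath par (par e) b := by
          rcases onPath_some.1 heb with h | h
          · exact absurd h.symm he
          · exact h
        exact hr.valid_of_liftBranch_add_single hb hv hpb (heven hv (by
          rw [hr.onPath_liftBranch hb]
          exact fun h => h.2 hpb rfl))
    · simp only at hk hv h1 hf hf0
      have hmg : 0 < m g := heven hv (by
          rw [hr.onPath_liftBranch hb]
          exact fun h => h.2 heb rfl)
      refine Or.inr ⟨hk, hr.valid_of_liftBranch_add_single hb hv heb hmg, hme.symm.trans h1, f, ?_, ?_⟩
      · rwa [liftBranch_of_ne] at hf
        rintro rfl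
        rw [liftBranch_self] at hf
        exact hgb'' (hf ▸ heb)
      · rcases pos_add_single.1 hf0 with rfl | h2
        · exact hmg
        · exact h2
  · have hne : e ≠ b := by
      rintro rfl
      exact heb (OnPath.here e)
    have hpb : ¬ OnPath par (par e) b := fun h => heb (OnPath.above _ _ h)
    by_cases hsp : e = g ∧ k = false ∧ 0 < m b
    · have hlow : lowerBirth par b g (e, k, m) = (g, true, m + Pi.single g 1) := by
        unfold lowerBirth
        rw [if_neg heb, if_pos hsp]
      rw [hlow]
      obtain ⟨rfl, rfl, hmb⟩ := hsp
      rcases hx with ⟨-, hv, h0⟩ | ⟨hk, -⟩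
      · simp only at hv h0
        rw [liftBranch_of_ne hne] at hv
        refine Or.inr ⟨rfl, ?_, by simp [h0], b, hb, pos_add_single.2 (Or.inr hmb)⟩
        have h1 := (hr.liftBranch hb).valid_down (e := e) (by rwa [liftBranch_of_ne hne])
        exact hr.valid_of_liftBranch hb h1 hgb (fun _ => pos_add_single.2 (Or.inl rfl))
      · simp at hk
    · have hlow : lowerBirth par b g (e, k, m) = (e, k, m) := by
        unfold lowerBirth
        rw [if_neg heb, if_neg hsp]
      rw [hlow]
      have hcg : ∀ {y}, Valid (liftBranch par b g) y m →
          ¬ OnPath par y b → (y = par e ∧ k = false ∨ y = some e ∧ k = true) →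
          0 < m b → 0 < m g := by
        intro y hv hyb hy hmb
        by_contra h0
        have h0' : m g = 0 := by omega
        have hng : ¬ OnPath par y g := by
          intro hyg
          have := (hv.1 g).2 ((hr.onPath_liftBranch hb y g).2 ⟨hyg, fun h => absurd h hyb⟩)
          simp [h0'] at this
        refine hns ⟨?_, ?_, h0', zero_of_liftBranch hc hbc hv h0',
          lt_two_of_mem_treeBirths hx⟩
        · rintro rfl
          rcases hy with ⟨rfl, rfl⟩ | ⟨rfl, rfl⟩
          · exact hsp ⟨rfl, rfl, hmb⟩
          · exact hng (OnPath.here _)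
        · rintro rfl
          rcases hy with ⟨rfl, rfl⟩ | ⟨rfl, rfl⟩
          · exact hng (hc ▸ OnPath.here _)
          · exact hng (OnPath.above _ _ (hc ▸ OnPath.here _))
      rcases hx with ⟨hk, hv, h0⟩ | ⟨hk, hv, h1, f, hf, hf0⟩
      · simp only at hk hv h0
        rw [liftBranch_of_ne hne] at hv
        exact Or.inl ⟨hk, hr.valid_of_liftBranch hb hv hpb (hcg hv hpb (Or.inl ⟨rfl, hk⟩)), h0⟩
      · simp only at hk hv h1 hf hf0
        have hmm := hcg hv heb (Or.inr ⟨rfl, hk⟩)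
        refine Or.inr ⟨hk, hr.valid_of_liftBranch hb hv heb hmm, h1, ?_⟩
        by_cases hfb : f = b
        · subst hfb
          rw [liftBranch_self] at hf
          -- In the old tree `b` no longer hangs from `e`; the edge `g`, which does, takes over as
          -- the used edge below `e`.
          exact ⟨g, hf, hmm hf0⟩
        · rw [liftBranch_of_ne hfb] at hf
          exact ⟨f, hf, hf0⟩

theorem lowerBirth_injOn (hr : IsRanked par h) (hb : par b = some g) (hc : par c = some g)
    (hbc : b ≠ c) :
    Set.InjOn (lowerBirth par b g) {x ∈ treeBirths (liftBranch par b g) | ¬ IsStray g c x} := by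
  rintro x ⟨hx, hxs⟩ y ⟨hy, hys⟩ hxy
  have h1 : x.1 = y.1 := by
    rw [← lowerBirth_fst (par := par) (b := b) (g := g) x, hxy, lowerBirth_fst]
  by_cases heb : OnPath par (some x.1) b
  · have hxg := pos_of_not_isStray hr hb hc hbc hx hxs heb
    have hyg := pos_of_not_isStray hr hb hc hbc hy hys (h1 ▸ heb)
    obtain ⟨e, k, m⟩ := x
    obtain ⟨e', k', m'⟩ := y
    obtain rfl : e = e' := h1
    simp only at hxg hyg heb
    obtain ⟨m, rfl, -⟩ := exists_eq_add_single hxg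
    obtain ⟨m', rfl, -⟩ := exists_eq_add_single hyg
    simpa [lowerBirth, heb] using hxy
  · obtain ⟨e, k, m⟩ := x
    obtain ⟨e', k', m'⟩ := y
    obtain rfl : e = e' := h1
    simp only at heb
    -- The image of a replaced birth cannot also be an unreplaced one: an ascending birth along `g`
    -- needs a used edge below `g` in the lifted tree, and with `m g = 0` there is none.
    have mixed : ∀ m : Fin n → ℕ, (g, false, m) ∈ treeBirths (liftBranch par b g) →
        (g, true, m + Pi.single g 1) ∈ treeBirths (liftBranch par b g) → False := by
      rintro m (⟨-, hv, h0⟩ | ⟨hk, -⟩) (⟨hk', -⟩ | ⟨-, hv', -, f, hf, hf0⟩)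
      · simp at hk'
      · simp only at hv h0 hf hf0
        have := hv.2 f g hf
        rcases pos_add_single.1 hf0 with rfl | h2
        · exact (hr.liftBranch hb).par_ne _ hf
        · omega
      · simp at hk
      · simp at hk
    unfold lowerBirth at hxy
    simp only [heb, if_false] at hxy
    split_ifs at hxy with h2 h3 h3
    · obtain ⟨rfl, rfl, -⟩ := h2
      obtain ⟨-, rfl, -⟩ := h3
      simpa using hxy
    · obtain ⟨rfl, rfl, -⟩ := h2
      rw [← hxy] at hy
      exact (mixed _ hx hy).elim
    · obtain ⟨rfl, rfl, -⟩ := h3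
      rw [hxy] at hx
      exact (mixed _ hy hx).elim
    · exact hxy

end SourcedGraph

/-! ### Lifting a branch: losses of order `n - 3` against a larger gain -/

namespace SourcedGraph

variable {n : ℕ}

variable {par : Fin n → Option (Fin n)} {h : Fin n → ℕ} {b c g : Fin n} {t : Fin n → ℝ}

theorem eq_update_add_single (m : Fin n → ℕ) (b : Fin n) :
    m = Function.update m b 0 + Pi.single b (m b) := by
  funext f
  by_cases hf : f = b
  · subst hf
    simp
  · simp [hf]

/-- There are `2 * n` choices of edge and direction; the coordinates at `g` and `c` vanish, the one
at the edge itself is 0 or 1, and the other `n - 3` are at most `K`. -/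
theorem ncard_isStray_le (hgc : g ≠ c) {T : ℝ} {K : ℕ}
    (hK : ∀ m, weight t m ≤ T → ∀ f, m f ≤ K) :
    {x : Fin n × Bool × (Fin n → ℕ) | IsStray g c x ∧ weight t x.2.2 ≤ T}.ncard ≤
      n * 2 * (2 * (K + 1) ^ (n - 3)) := by
  classical
  let F : Fin n × Bool → Finset (Fin n × Bool × (Fin n → ℕ)) := fun p =>
    if p.1 ≠ g ∧ p.1 ≠ c then (box g c p.1 2 K).image fun m => (p.1, p.2, m) else ∅
  have hsub : {x : Fin n × Bool × (Fin n → ℕ) | IsStray g c x ∧ weight t x.2.2 ≤ T} ⊆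
      (Finset.univ.biUnion F : Finset _) := by
    rintro ⟨e, k, m⟩ ⟨⟨h1, h2, h3, h4, h5⟩, hT⟩
    simp only at h1 h2 h3 h4 h5 hT
    rw [Finset.mem_coe, Finset.mem_biUnion]
    refine ⟨(e, k), Finset.mem_univ _, ?_⟩
    simp only [F]
    rw [if_pos ⟨h1, h2⟩, Finset.mem_image]
    exact ⟨m, (mem_box h1 h2).2 ⟨h3, h4, h5, fun f _ _ _ => hK m hT f⟩, rfl⟩
  refine (Set.ncard_le_ncard hsub (Finset.finite_toSet _)).trans ?_
  rw [Set.ncard_coe_finset]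
  refine (Finset.card_biUnion_le_card_mul _ _ (2 * (K + 1) ^ (n - 3)) ?_).trans ?_
  · rintro ⟨e, k⟩ -
    simp only [F]
    split_ifs with he
    · exact Finset.card_image_le.trans (card_box hgc he.1 he.2 2 K).le
    · simp
  · simp

/-- Once the other coordinates are fixed, two values of `m b` congruent mod `Q` change the weight by
at least `Q * t b ≥ w`, too much for a window of width `w`. So the residue of `m b` suffices. -/
theorem ncard_window_le (ht : ∀ e, 0 < t e) (hgc : g ≠ c) (hbg : b ≠ g) (hbc : b ≠ c) {T w : ℝ}
    {K Q : ℕ} (hK : ∀ m, weight t m ≤ T → ∀ f, m f ≤ K) (hQ0 : 0 < Q) (hQ : w ≤ Q * t b) :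
    {m : Fin n → ℕ | m g = 0 ∧ m c = 0 ∧ T - w < weight t m ∧ weight t m ≤ T}.ncard ≤
      Q * (K + 1) ^ (n - 3) := by
  rw [← card_box hgc hbg hbc Q K, ← Set.ncard_coe_finset]
  refine Set.ncard_le_ncard_of_injOn (fun m => Function.update m b (m b % Q)) ?_ ?_
    (Finset.finite_toSet _)
  · rintro m ⟨h1, h2, -, h4⟩
    rw [Finset.mem_coe, mem_box hbg hbc]
    refine ⟨?_, ?_, ?_, fun f _ _ hf => ?_⟩
    · simpa [Function.update_of_ne hbg.symm] using h1
    · simpa [Function.update_of_ne hbc.symm] using h2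
    · simpa using Nat.mod_lt _ hQ0
    · simpa [Function.update_of_ne hf] using hK m h4 f
  · rintro m ⟨-, -, h3, h4⟩ m' ⟨-, -, h3', h4'⟩ heq
    simp only at heq
    have hupd : Function.update m b 0 = Function.update m' b 0 := by
      have := congrArg (fun v => Function.update v b 0) heq
      simpa using this
    have hmod : m b % Q = m' b % Q := by
      have := congrFun heq b
      simpa using this
    have key : ∀ m m' : Fin n → ℕ, Function.update m b 0 = Function.update m' b 0 →
        T - w < weight t m → weight t m' ≤ T → m b % Q = m' b % Q → m' b ≤ m b := by
      intro m m' hupd h3 h4 hmod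
      have e1 : weight t m = weight t (Function.update m b 0) + m b * t b := by
        conv_lhs => rw [eq_update_add_single m b, weight_add, weight_single]
      have e2 : weight t m' = weight t (Function.update m' b 0) + m' b * t b := by
        conv_lhs => rw [eq_update_add_single m' b, weight_add, weight_single]
      rw [← hupd] at e2
      by_contra! hlt
      have h5 : m b + Q ≤ m' b := by
        have h6 := (Nat.modEq_iff_dvd' hlt.le).1 hmod
        have := Nat.le_of_dvd (by omega) h6
        omega
      have h6 : ((m b : ℝ) + Q) * t b ≤ m' b * t b := by
        have : (m b : ℝ) + Q ≤ m' b := by exact_mod_cast h5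
        exact mul_le_mul_of_nonneg_right this (ht b).le
      linarith
    have hb : m b = m' b :=
      le_antisymm (key m' m hupd.symm h3' h4 hmod.symm) (key m m' hupd h3 h4' hmod)
    rw [eq_update_add_single m b, eq_update_add_single m' b, hupd, hb]

theorem mem_treeBirths_of_pos (hr : IsRanked par h) (hb : par b = some g)
    {m : Fin n → ℕ} {k : Bool} (hk : k = true ↔ ∃ f, par f = some b)
    (hmb : m b = if k then 1 else 0) (hpos : ∀ f, f ≠ b → 0 < m f)
    (hodd : ∀ f, f ≠ b → (Odd (m f) ↔ OnPath par (some g) f)) :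
    (b, k, m) ∈ treeBirths par := by
  have hgb := hr.not_onPath_of_par_eq hb
  cases k with
  | false =>
    simp only [Bool.false_eq_true, false_iff, not_exists, if_false] at hk hmb
    refine Or.inl ⟨rfl, ⟨fun e => ?_, fun e p hp _ => ?_⟩, hmb⟩
    · simp only [hb]
      by_cases he : e = b
      · subst he
        simp [hmb, hgb]
      · exact hodd e he
    · apply hpos
      rintro rfl
      exact hk e hp
  | true =>
    simp only [true_iff, if_true] at hk hmb
    obtain ⟨f, hf⟩ := hk
    refine Or.inr ⟨rfl, ⟨fun e => ?_, fun e p hp _ => ?_⟩, hmb, f, hf, hpos f ?_⟩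
    · rw [onPath_some]
      simp only [hb]
      by_cases he : e = b
      · subst he
        simp [hmb]
      · simpa [he] using hodd e he
    · by_cases hpb : p = b
      · subst hpb
        simp [hmb]
      · exact hpos p hpb
    · rintro rfl
      exact hr.par_ne f hf

theorem weight_le_of_forall_le (ht : ∀ e, 0 < t e) {m : Fin n → ℕ} {K : ℕ} (hm : ∀ f, m f ≤ K) :
    weight t m ≤ K * ∑ e, t e := by
  rw [Finset.mul_sum]
  refine Finset.sum_le_sum fun e _ => ?_
  have : (m e : ℝ) ≤ K := by exact_mod_cast hm e
  exact mul_le_mul_of_nonneg_right this (ht e).le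

/-- Adding even numbers to a fixed birth vector, away from `b`, keeps all parities. The coordinates
outside `g`, `c`, `b` are chosen freely in a box, and those at `g` and `c` then steer the weight
into the window in `M` ways. -/
theorem le_ncard_treeBirths_window (ht : ∀ e, 0 < t e) (hind : LinearIndependent ℚ t)
    (hr : IsRanked par h) (hb : par b = some g) (hgc : g ≠ c) (hbg : b ≠ g) (hbc : b ≠ c)
    (M : ℕ) :
    ∃ T₀ : ℝ, ∀ T, T₀ ≤ T → ∀ K : ℕ, 2 * (K * ∑ e, t e) ≤ T / 2 →
      M * (K + 1) ^ (n - 3) ≤ {x ∈ treeBirths par |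
        x.1 = b ∧ T - t g < weight t x.2.2 ∧ weight t x.2.2 ≤ T}.ncard := by
  classical
  have hirr : Irrational ((2 * t g) / (2 * t c)) := by
    rw [mul_div_mul_left _ _ two_ne_zero]
    exact irrational_div_of_linearIndependent ht hind hgc
  obtain ⟨X₀, hX₀⟩ := exists_nat_combinations_mem_Ioc (w := t g)
    (mul_pos two_pos (ht g)) hirr (ht g) M
  let k : Bool := decide (∃ f, par f = some b)
  -- The smallest vector with the right parities that is positive away from `b`. At `b` it describes
  -- an ascending birth if `b` has an edge below it, and a descending one otherwise.
  let base : Fin n → ℕ := fun f =>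
    if f = b then (if k then 1 else 0) else if OnPath par (some g) f then 1 else 2
  refine ⟨2 * (X₀ + t g + weight t base), fun T hT K hK => ?_⟩
  have hsel : ∀ κ ∈ box g c b 1 K, ∃ f : Fin M → ℕ × ℕ, Function.Injective f ∧
      ∀ l, ((f l).1 : ℝ) * (2 * t g) + (f l).2 * (2 * t c) ∈
        Set.Ioc (T - t g - weight t base - 2 * weight t κ)
          (T - weight t base - 2 * weight t κ) := by
    intro κ hκ
    rw [mem_box hbg hbc] at hκ
    obtain ⟨h1, h2, h3, h4⟩ := hκ
    have hle : weight t κ ≤ K * ∑ e, t e := by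
      apply weight_le_of_forall_le ht
      intro f
      by_cases hfg : f = g
      · simp [hfg, h1]
      by_cases hfc : f = c
      · simp [hfc, h2]
      by_cases hfb : f = b
      · rw [hfb]
        omega
      exact h4 f hfg hfc hfb
    obtain ⟨f, hf1, hf2⟩ := hX₀ (T - t g - weight t base - 2 * weight t κ) (by linarith)
    refine ⟨f, hf1, fun l => ?_⟩
    have := hf2 l
    rwa [show T - t g - weight t base - 2 * weight t κ + t g =
      T - weight t base - 2 * weight t κ by ring] at this
  choose! F hFinj hF using hsel
  let V : (Fin n → ℕ) × Fin M → Fin n → ℕ := fun p =>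
    p.1 + (Pi.single g (F p.1 p.2).1 + Pi.single c (F p.1 p.2).2)
  have hVg : ∀ p, p.1 ∈ box g c b 1 K → V p g = (F p.1 p.2).1 := by
    intro p hp
    simp [V, ((mem_box hbg hbc).1 hp).1, hgc]
  have hVc : ∀ p, p.1 ∈ box g c b 1 K → V p c = (F p.1 p.2).2 := by
    intro p hp
    simp [V, ((mem_box hbg hbc).1 hp).2.1, hgc.symm]
  have hV : ∀ p f, f ≠ g → f ≠ c → V p f = p.1 f := by
    intro p f h1 h2
    simp [V, h1, h2]
  have hcard : (box g c b 1 K ×ˢ (Finset.univ : Finset (Fin M))).card = M * (K + 1) ^ (n - 3) := by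
    rw [Finset.card_product, card_box hgc hbg hbc, Finset.card_univ, Fintype.card_fin]
    ring
  rw [← hcard, ← Set.ncard_coe_finset]
  refine Set.ncard_le_ncard_of_injOn
    (fun p => (b, k, base + (V p + V p))) ?_ ?_ ?_
  · rintro ⟨κ, l⟩ hp
    rw [Finset.mem_coe, Finset.mem_product] at hp
    have hκ := hp.1
    simp only at hκ
    refine ⟨mem_treeBirths_of_pos hr hb (by simp [k]) ?_ ?_ ?_, rfl, ?_⟩
    · have h3 := ((mem_box hbg hbc).1 hκ).2.2.1
      simp only [Pi.add_apply, hV _ b hbg hbc, base, if_true]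
      omega
    · intro f hf
      simp only [Pi.add_apply, base, hf, if_false]
      split_ifs <;> omega
    · intro f hf
      simp only [Pi.add_apply, base, hf, if_false]
      split_ifs with h1
      · simp [h1]
      · simp [h1, Nat.odd_add]
    · have hw : weight t (base + (V (κ, l) + V (κ, l))) = weight t base + 2 * weight t κ +
          (((F κ l).1 : ℝ) * (2 * t g) + (F κ l).2 * (2 * t c)) := by
        simp only [V, weight_add, weight_single]
        ring
      have := hF κ hκ l
      simp only [hw]
      exact ⟨by linarith [this.1], by linarith [this.2]⟩
  · rintro ⟨κ, l⟩ hp ⟨κ', l'⟩ hp' heq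
    rw [Finset.mem_coe, Finset.mem_product] at hp hp'
    have hVV : ∀ f, V (κ, l) f = V (κ', l') f := by
      intro f
      simp only [Prod.mk.injEq, true_and] at heq
      have := congrFun heq f
      simp only [Pi.add_apply] at this
      omega
    obtain rfl : κ = κ' := by
      funext f
      by_cases hfg : f = g
      · rw [hfg]
        exact ((mem_box hbg hbc).1 hp.1).1.trans ((mem_box hbg hbc).1 hp'.1).1.symm
      by_cases hfc : f = c
      · rw [hfc]
        exact ((mem_box hbg hbc).1 hp.1).2.1.trans ((mem_box hbg hbc).1 hp'.1).2.1.symm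
      have := hVV f
      rwa [hV _ f hfg hfc, hV _ f hfg hfc] at this
    have h1 := hVV g
    rw [hVg _ hp.1, hVg _ hp'.1] at h1
    have h2 := hVV c
    rw [hVc _ hp.1, hVc _ hp'.1] at h2
    exact congrArg (Prod.mk κ) (hFinj κ hp.1 (Prod.ext h1 h2))
  · exact (finite_treeBirths par ht T).subset fun x hx => ⟨hx.1, hx.2.2.2⟩

/-- A comparison of the births up to the time `T` in the tree with a lifted branch and in the original
tree, where the births along `b` happen earlier by `t g`. -/
theorem ncard_treeBirths_liftBranch_add_le (ht : ∀ e, 0 < t e)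
    (hr : IsRanked par h) (hb : par b = some g) (hc : par c = some g) (hbc : b ≠ c) (T : ℝ) :
    {x ∈ treeBirths (liftBranch par b g) | weight t x.2.2 ≤ T}.ncard +
      {x ∈ treeBirths par |
        x.1 = b ∧ T - t g < weight t x.2.2 ∧ weight t x.2.2 ≤ T}.ncard ≤
    {x ∈ treeBirths par | weight t x.2.2 ≤ T}.ncard +
      ({x : Fin n × Bool × (Fin n → ℕ) | IsStray g c x ∧ weight t x.2.2 ≤ T}.ncard +
      {m : Fin n → ℕ | m g = 0 ∧ m c = 0 ∧ T - t g < weight t m ∧ weight t m ≤ T}.ncard) := by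
  set A' := {x ∈ treeBirths (liftBranch par b g) | weight t x.2.2 ≤ T} with hA'
  set A := {x ∈ treeBirths par | weight t x.2.2 ≤ T} with hA
  set W := {x ∈ treeBirths par | x.1 = b ∧ T - t g < weight t x.2.2 ∧ weight t x.2.2 ≤ T} with hW
  set S := {x : Fin n × Bool × (Fin n → ℕ) | IsStray g c x ∧ weight t x.2.2 ≤ T} with hS
  set L := {m : Fin n → ℕ | m g = 0 ∧ m c = 0 ∧ T - t g < weight t m ∧ weight t m ≤ T} with hL
  have hAfin : A.Finite := finite_treeBirths par ht T
  have hA'fin : A'.Finite := finite_treeBirths _ ht T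
  have hLfin : L.Finite := (finite_weight_le ht T).subset fun m hm => hm.2.2.2
  have hSfin : S.Finite := by
    refine ((Set.finite_univ (α := Fin n)).prod ((Set.finite_univ (α := Bool)).prod
      (finite_weight_le ht T))).subset ?_
    rintro ⟨e, k, m⟩ hx
    exact ⟨trivial, trivial, hx.2⟩
  -- First descents along `g` may be replaced by ascents later by `t g`; those pushed beyond `T` are
  -- discarded here.
  set L' : Set (Fin n × Bool × (Fin n → ℕ)) := (fun m => (g, false, m)) '' L with hL'
  have hWA : W ⊆ A := fun x hx => ⟨hx.1, hx.2.2.2⟩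
  have hbb : OnPath par (some b) b := OnPath.here b
  have hmap : (A' \ (S ∪ L')).ncard ≤ (A \ W).ncard := by
    refine Set.ncard_le_ncard_of_injOn (lowerBirth par b g) ?_ ?_ hAfin.sdiff
    · rintro x ⟨⟨hx, hxT⟩, hbad⟩
      have hns : ¬ IsStray g c x := fun hs => hbad (Or.inl ⟨hs, hxT⟩)
      have hmem := lowerBirth_mem hr hb hc hbc hx hns
      by_cases heb : OnPath par (some x.1) b
      · have hpos := pos_of_not_isStray hr hb hc hbc hx hns heb
        obtain ⟨e, k, m⟩ := x
        obtain ⟨m, rfl, -⟩ := exists_eq_add_single hpos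
        have hlow : lowerBirth par b g (e, k, m + Pi.single g 1) = (e, k, m) := by
          unfold lowerBirth
          rw [if_pos heb, add_tsub_cancel_right]
        rw [hlow] at hmem ⊢
        simp only [weight_add, weight_single] at hxT
        push_cast at hxT
        -- The image has weight at most `T - t g`, so it misses the window `W`.
        refine ⟨⟨hmem, ?_⟩, fun hw => ?_⟩
        · simp only
          linarith [ht g]
        · have := hw.2.2.1
          simp only at this
          linarith
      · refine ⟨⟨hmem, ?_⟩, fun hw => ?_⟩
        · unfold lowerBirth
          rw [if_neg heb]
          split_ifs with hsp
          · obtain ⟨e, k, m⟩ := x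
            obtain ⟨rfl, rfl, hmb⟩ := hsp
            simp only [weight_add, weight_single]
            by_contra! hlt
            push_cast at hlt
            rcases hx with ⟨-, hv, h0⟩ | ⟨hk, -⟩
            · refine hbad (Or.inr ⟨m, ⟨h0, zero_of_liftBranch hc hbc hv h0, ?_, hxT⟩, rfl⟩)
              linarith
            · simp at hk
          · exact hxT
        · have := hw.2.1
          rw [lowerBirth_fst] at this
          rw [this] at heb
          exact heb hbb
    · refine (lowerBirth_injOn hr hb hc hbc).mono ?_
      rintro x ⟨⟨hx, hxT⟩, hbad⟩
      exact ⟨hx, fun hs => hbad (Or.inl ⟨hs, hxT⟩)⟩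
  have h1 := Set.ncard_sdiff_add_ncard_of_subset hWA hAfin
  have h2 : A'.ncard ≤ (A' \ (S ∪ L')).ncard + (S ∪ L').ncard :=
    Set.ncard_le_ncard_sdiff_add_ncard A' (S ∪ L') (hSfin.union (hLfin.image _))
  have h3 := Set.ncard_union_le S L'
  have h4 : L'.ncard ≤ L.ncard := Set.ncard_image_le hLfin
  omega

/-- Lifting one of several branches at a vertex other than the root makes the tree grow slower. -/
theorem exists_ncard_treeBirths_lt (ht : ∀ e, 0 < t e) (hind : LinearIndependent ℚ t)
    (hr : IsRanked par h) (hb : par b = some g) (hc : par c = some g) (hbc : b ≠ c) :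
    ∃ T₀ : ℝ, ∀ T, T₀ ≤ T →
      {x ∈ treeBirths (liftBranch par b g) | weight t x.2.2 ≤ T}.ncard <
        {x ∈ treeBirths par | weight t x.2.2 ≤ T}.ncard := by
  have hbg : b ≠ g := by
    rintro rfl
    exact hr.par_ne _ hb
  have hgc : g ≠ c := by
    rintro rfl
    exact hr.par_ne _ hc
  obtain ⟨a, ha0, ha⟩ : ∃ a > 0, ∀ f, a ≤ t f := by
    obtain ⟨f, -, hf⟩ := Finset.exists_min_image Finset.univ t ⟨b, Finset.mem_univ b⟩
    exact ⟨t f, ht f, fun f' => hf f' (Finset.mem_univ f')⟩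
  set S : ℝ := ∑ e, t e with hS
  have hS0 : 0 < S := Finset.sum_pos (fun e _ => ht e) ⟨b, Finset.mem_univ b⟩
  -- `R` bounds the ratio of the box size `K + 1`, used for the losses, to the box size `K' + 1`,
  -- used for the gain; `M` is then chosen to beat the losses.
  set R : ℕ := ⌈8 * S / a⌉₊ with hR
  set Q : ℕ := ⌈t g / t b⌉₊ with hQ
  have hQ0 : 0 < Q := Nat.ceil_pos.2 (div_pos (ht g) (ht b))
  have hQ1 : t g ≤ Q * t b := (div_le_iff₀ (ht b)).1 (Nat.le_ceil _)
  set M : ℕ := (n * 2 * 2 + Q) * R ^ (n - 3) + 1 with hM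
  obtain ⟨T₀, hT₀⟩ := le_ncard_treeBirths_window ht hind hr hb hgc hbg hbc M
  refine ⟨max T₀ a, fun T hT => ?_⟩
  have hTa : a ≤ T := (le_max_right _ _).trans hT
  have hT0 : 0 < T := ha0.trans_le hTa
  set K : ℕ := ⌊T / a⌋₊ with hKdef
  set K' : ℕ := ⌊T / (4 * S)⌋₊ with hK'def
  have hK : ∀ m, weight t m ≤ T → ∀ f, m f ≤ K := by
    intro m hm f
    apply Nat.le_floor
    rw [le_div_iff₀ ha0]
    exact (mul_le_mul_of_nonneg_left (ha f) (Nat.cast_nonneg _)).trans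
      ((mul_le_weight ht m f).trans hm)
  have hK' : 2 * (K' * S) ≤ T / 2 := by
    have : (K' : ℝ) * (4 * S) ≤ T :=
      (le_div_iff₀ (by positivity)).1 (Nat.floor_le (by positivity))
    linarith
  have hKK : K + 1 ≤ R * (K' + 1) := by
    have h1 : (K : ℝ) ≤ T / a := Nat.floor_le (by positivity)
    have h2 : T / (4 * S) < K' + 1 := Nat.lt_floor_add_one _
    have h3 : 8 * S / a ≤ R := Nat.le_ceil _
    have h4 : 8 * S / a * (T / (4 * S)) = 2 * (T / a) := by
      field_simp
      norm_num
    have h5 : 1 ≤ T / a := (one_le_div ha0).2 hTa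
    have h6 : 8 * S / a * (T / (4 * S)) ≤ R * (K' + 1) := by
      gcongr
    have : (K : ℝ) + 1 ≤ R * (K' + 1) := by linarith
    exact_mod_cast this
  have hW := hT₀ T ((le_max_left _ _).trans hT) K' hK'
  have hst := ncard_isStray_le (t := t) hgc hK
  have hwin := ncard_window_le ht hgc hbg hbc hK hQ0 hQ1
  have hall := ncard_treeBirths_liftBranch_add_le ht hr hb hc hbc T
  have hpow : (n * 2 * 2 + Q) * (K + 1) ^ (n - 3) < M * (K' + 1) ^ (n - 3) := by
    calc (n * 2 * 2 + Q) * (K + 1) ^ (n - 3)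
        ≤ (n * 2 * 2 + Q) * (R * (K' + 1)) ^ (n - 3) := by gcongr
      _ = (n * 2 * 2 + Q) * R ^ (n - 3) * (K' + 1) ^ (n - 3) := by rw [mul_pow]; ring
      _ < M * (K' + 1) ^ (n - 3) := by
        apply Nat.mul_lt_mul_of_pos_right (by omega) (by positivity)
  have hexp : (n * 2 * 2 + Q) * (K + 1) ^ (n - 3) =
      n * 2 * (2 * (K + 1) ^ (n - 3)) + Q * (K + 1) ^ (n - 3) := by ring
  omega

end SourcedGraph

/-! ### Connected graphs as quotients of trees -/

namespace SourcedGraph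

variable {n : ℕ}

section

variable (Γ : SourcedGraph n)

theorem isWalk_append {u v : Γ.V} {p q : List (Fin n × Bool)} :
    Γ.IsWalk u (p ++ q) v ↔ ∃ w, Γ.IsWalk u p w ∧ Γ.IsWalk w q v := by
  induction p generalizing u with
  | nil => simp [IsWalk]
  | cons d p ih => simp [IsWalk, ih, and_assoc]

theorem Connected.exists_dist (hconn : Γ.Connected) :
    ∃ δ : Γ.V → ℕ, ∀ v, v ≠ Γ.root → ∃ d, Γ.head d = v ∧ δ (Γ.tail d) < δ v := by
  classical
  have hex : ∀ v, ∃ k, ∃ p, Γ.IsWalk Γ.root p v ∧ p.length = k := fun v =>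
    let ⟨p, hp⟩ := hconn Γ.root v
    ⟨_, p, hp, rfl⟩
  refine ⟨fun v => Nat.find (hex v), fun v hv => ?_⟩
  obtain ⟨p, hp, hlen⟩ := Nat.find_spec (hex v)
  rcases List.eq_nil_or_concat p with rfl | ⟨q, d, rfl⟩
  · exact absurd hp.symm hv
  · rw [List.concat_eq_append, isWalk_append] at hp
    obtain ⟨w, hq, rfl, hd⟩ := hp
    refine ⟨d, hd, ?_⟩
    dsimp only
    rw [← hlen, List.length_concat]
    exact Nat.lt_succ_of_le (Nat.find_min' _ ⟨q, hq, rfl⟩)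

/-- A connected graph is obtained from a tree with the same edges by gluing vertices. -/
theorem Connected.exists_treeGraph (hconn : Γ.Connected) :
    ∃ (par : Fin n → Option (Fin n)) (up : Fin n → Bool) (h : Fin n → ℕ)
      (π : Option (Fin n) → Γ.V), IsRanked par h ∧ π none = Γ.root ∧
      (∀ e b, π ((treeGraph par up).endpt e b) = Γ.endpt e b) ∧ Function.Surjective π := by
  classical
  obtain ⟨δ, hδ⟩ := hconn.exists_dist
  rcases isEmpty_or_nonempty (Fin n × Bool) with hempty | hnonempty
  · refine ⟨fun _ => none, fun _ => false, fun _ => 0, fun _ => Γ.root, ?_, rfl, ?_, ?_⟩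
    · intro e p hp
      simp at hp
    · exact fun e b => hempty.elim (e, b)
    · intro v
      refine ⟨none, ?_⟩
      by_contra hv
      obtain ⟨d, -⟩ := hδ v (Ne.symm hv)
      exact hempty.elim d
  -- The edges `D v` form a spanning tree of shortest paths. Any other edge keeps one end where it
  -- is, and its other end is cut off as a new leaf.
  choose! D hDhead hDδ using hδ
  -- No edge is chosen in both directions, since `δ` increases along each chosen one.
  have huniq : ∀ v w, v ≠ Γ.root → w ≠ Γ.root → (D v).1 = (D w).1 → (D v).2 = (D w).2 := by
    intro v w hv hw h1
    by_contra h2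
    have h3 : (D w).2 = !(D v).2 := by
      revert h2
      cases (D v).2 <;> cases (D w).2 <;> simp
    have h4 : Γ.head (D w) = Γ.tail (D v) := by simp [head, tail, h1, h3]
    have h5 : Γ.tail (D w) = Γ.head (D v) := by simp [head, tail, h1, h3]
    have h6 := hDδ v hv
    have h7 := hDδ w hw
    rw [← h4, hDhead w hw] at h6
    rw [h5, hDhead v hv] at h7
    omega
  let up : Fin n → Bool := fun e =>
    if hx : ∃ v, v ≠ Γ.root ∧ (D v).1 = e then (D hx.choose).2 else false
  have hup : ∀ v, v ≠ Γ.root → up (D v).1 = (D v).2 := by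
    intro v hv
    have hx : ∃ w, w ≠ Γ.root ∧ (D w).1 = (D v).1 := ⟨v, hv, rfl⟩
    simp only [up]
    rw [dif_pos hx]
    exact huniq _ _ hx.choose_spec.1 hv hx.choose_spec.2
  let par : Fin n → Option (Fin n) := fun e =>
    if Γ.endpt e (up e) = Γ.root then none else some (D (Γ.endpt e (up e))).1
  let π : Option (Fin n) → Γ.V := fun x => x.elim Γ.root fun e => Γ.endpt e (!up e)
  have hπD : ∀ v, v ≠ Γ.root → π (some (D v).1) = v := by
    intro v hv
    change Γ.endpt (D v).1 (!up (D v).1) = v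
    rw [hup v hv]
    exact hDhead v hv
  have hπpar : ∀ e, π (par e) = Γ.endpt e (up e) := by
    intro e
    simp only [par]
    split_ifs with hroot
    · exact hroot.symm
    · exact hπD _ hroot
  refine ⟨par, up, fun e => δ (Γ.endpt e (up e)), π, ?_, rfl, ?_, ?_⟩
  · intro e p hp
    simp only [par] at hp
    split_ifs at hp with hroot
    obtain rfl := Option.some.inj hp
    simp only [hup _ hroot]
    exact hDδ _ hroot
  · intro e b
    change π (if b = up e then par e else some e) = _
    split_ifs with hb
    · rw [hπpar, hb]
    · change Γ.endpt e (!up e) = _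
      congr 1
      revert hb
      cases b <;> cases up e <;> simp
  · intro v
    by_cases hv : v = Γ.root
    · exact ⟨none, hv.symm⟩
    · exact ⟨some (D v).1, hπD v hv⟩

end

section

variable {par : Fin n → Option (Fin n)} {up : Fin n → Bool} {h : Fin n → ℕ} {t : Fin n → ℝ}

theorem IsRanked.treeGraph_connected (hr : IsRanked par h) : (treeGraph par up).Connected := by
  have h1 : ∀ x : Option (Fin n), (∃ p, (treeGraph par up).IsWalk none p x) ∧
      ∃ p, (treeGraph par up).IsWalk x p none := by
    refine hr.induction ⟨⟨[], rfl⟩, ⟨[], rfl⟩⟩ ?_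
    rintro e ⟨⟨p, hp⟩, ⟨q, hq⟩⟩
    constructor
    · exact ⟨p ++ [(e, up e)], (isWalk_append _).2
        ⟨_, hp, treeGraph_tail_up up e, treeGraph_head_up up e⟩⟩
    · refine ⟨(e, !up e) :: q, treeGraph_tail_not_up up e, ?_⟩
      rw [treeGraph_head_not_up]
      exact hq
  intro x y
  obtain ⟨p, hp⟩ := (h1 x).2
  obtain ⟨q, hq⟩ := (h1 y).1
  exact ⟨p ++ q, (isWalk_append _).2 ⟨_, hp, hq⟩⟩

theorem treeGraph_ends (e : Fin n) :
    s((treeGraph par up).endpt e false, (treeGraph par up).endpt e true) = s(par e, some e) := by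
  change s((if false = up e then par e else some e), (if true = up e then par e else some e)) = _
  cases up e <;> simp [Sym2.eq_swap]

theorem IsRanked.treeGraph_isSimple (hr : IsRanked par h) : (treeGraph par up).IsSimple := by
  constructor
  · intro e he
    have h1 := treeGraph_ends (par := par) (up := up) e
    rw [he] at h1
    rcases Sym2.eq_iff.1 h1 with ⟨h1, h2⟩ | ⟨h1, h2⟩
    · exact hr.par_ne e (h1.symm.trans h2)
    · exact hr.par_ne e (h2.symm.trans h1)
  · intro e f hef
    rw [treeGraph_ends, treeGraph_ends] at hef
    rcases Sym2.eq_iff.1 hef with ⟨-, h2⟩ | ⟨h1, h2⟩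
    · exact Option.some.inj h2
    · have := hr e f h1
      have := hr f e h2.symm
      omega

theorem IsRanked.treeGraph_mem (hr : IsRanked par h) {𝒢 : Set (SourcedGraph n)}
    (h𝒢 : 𝒢 = {Γ | Γ.Connected} ∨ 𝒢 = {Γ | Γ.Connected ∧ Γ.IsSimple}) :
    treeGraph par up ∈ 𝒢 := by
  rcases h𝒢 with rfl | rfl
  · exact hr.treeGraph_connected
  · exact ⟨hr.treeGraph_connected, hr.treeGraph_isSimple⟩

/-- Traverse the edges on the path an odd number of times and all others a positive even number of
times, adding `2 * j` throughout. -/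
theorem exists_valid_weight_ge (ht : ∀ e, 0 < t e) (e : Fin n) (x : Option (Fin n)) (T : ℝ) : ∃ m, Valid par x m ∧ T ≤ weight t m := by
  classical
  have hT : ∃ j : ℕ, T ≤ j * t e := by
    obtain ⟨j, hj⟩ := exists_nat_ge (T / t e)
    exact ⟨j, (div_le_iff₀ (ht e)).1 hj⟩
  obtain ⟨j, hj⟩ := hT
  refine ⟨fun f => (if OnPath par x f then 1 else 2) + 2 * j, ⟨fun f => ?_, fun f p _ _ => ?_⟩, ?_⟩
  · dsimp only
    split_ifs with hf <;> simp [hf, Nat.odd_add]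
  · dsimp only
    split_ifs <;> omega
  · refine hj.trans (le_trans ?_ (mul_le_weight ht _ e))
    refine mul_le_mul_of_nonneg_right ?_ (ht e).le
    push_cast
    have : (0 : ℝ) ≤ j := Nat.cast_nonneg j
    split_ifs <;> linarith

variable {Γ : SourcedGraph n} {π : Option (Fin n) → Γ.V}

theorem Emits.map_of_treeGraph (hπ0 : π none = Γ.root)
    (hπ : ∀ e b, π ((treeGraph par up).endpt e b) = Γ.endpt e b) {x : (treeGraph par up).V}
    {s : ℝ} (hs : (treeGraph par up).Emits t x s) : Γ.Emits t (π x) s := by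
  induction hs with
  | start =>
    change Γ.Emits t (π none) 0
    rw [hπ0]
    exact Emits.start
  | arrive d s _ ih =>
    have h1 : π ((treeGraph par up).tail d) = Γ.tail d := hπ _ _
    have h2 : π ((treeGraph par up).head d) = Γ.head d := hπ _ _
    rw [h1] at ih
    rw [h2]
    exact Emits.arrive d s ih

theorem finite_pointsAfter (Γ : SourcedGraph n) (ht : ∀ e, 0 < t e) (T : ℝ) :
    (Γ.pointsAfter t T).Finite :=
  (Γ.finite_emits ht T).subset fun _ hx => ⟨hx.1, hx.2.1⟩

theorem finite_pointsBefore (Γ : SourcedGraph n) (ht : ∀ e, 0 < t e) (T : ℝ) :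
    (Γ.pointsBefore t T).Finite :=
  (Γ.finite_emits ht T).subset fun _ hx => ⟨hx.1, hx.2.1.le⟩

theorem pointsAfter_treeGraph_subset (hπ0 : π none = Γ.root)
    (hπ : ∀ e b, π ((treeGraph par up).endpt e b) = Γ.endpt e b) (T : ℝ) :
    (treeGraph par up).pointsAfter t T ⊆ Γ.pointsAfter t T := by
  rintro ⟨d, s⟩ ⟨h1, h2⟩
  have := h1.map_of_treeGraph hπ0 hπ
  rw [show π ((treeGraph par up).tail d) = Γ.tail d from hπ _ _] at this
  exact ⟨this, h2⟩

theorem pointsBefore_treeGraph_subset (hπ0 : π none = Γ.root)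
    (hπ : ∀ e b, π ((treeGraph par up).endpt e b) = Γ.endpt e b) (T : ℝ) :
    (treeGraph par up).pointsBefore t T ⊆ Γ.pointsBefore t T := by
  rintro ⟨d, s⟩ ⟨h1, h2⟩
  have := h1.map_of_treeGraph hπ0 hπ
  rw [show π ((treeGraph par up).tail d) = Γ.tail d from hπ _ _] at this
  exact ⟨this, h2⟩

theorem N_treeGraph_le (ht : ∀ e, 0 < t e) (hπ0 : π none = Γ.root)
    (hπ : ∀ e b, π ((treeGraph par up).endpt e b) = Γ.endpt e b) (T : ℝ) :
    (treeGraph par up).N t T ≤ Γ.N t T := by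
  have h1 := Set.ncard_le_ncard (pointsAfter_treeGraph_subset (t := t) hπ0 hπ T)
    (Γ.finite_pointsAfter ht T)
  have h2 := Set.ncard_le_ncard (pointsBefore_treeGraph_subset (t := t) hπ0 hπ T)
    (Γ.finite_pointsBefore ht T)
  unfold N
  gcongr

/-- A graph that grows no faster than a tree from which it is obtained by gluing vertices is equal
to this tree. -/
theorem injective_of_growsNoFaster (hr : IsRanked par h) (ht : ∀ e, 0 < t e)
    (hind : LinearIndependent ℚ t) (hπ0 : π none = Γ.root)
    (hπ : ∀ e b, π ((treeGraph par up).endpt e b) = Γ.endpt e b)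
    (hle : GrowsNoFaster t Γ (treeGraph par up)) : Function.Injective π := by
  obtain ⟨T₀, hT₀⟩ := Filter.eventually_atTop.1 hle
  have hem : ∀ d s, T₀ ≤ s → Γ.Emits t (Γ.tail d) s →
      (treeGraph par up).Emits t ((treeGraph par up).tail d) s := by
    intro d s hs hd
    have h1 := Set.ncard_le_ncard (pointsAfter_treeGraph_subset (t := t) hπ0 hπ s)
      (Γ.finite_pointsAfter ht s)
    have h2 := Set.ncard_le_ncard (pointsBefore_treeGraph_subset (t := t) hπ0 hπ s)
      (Γ.finite_pointsBefore ht s)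
    have h3 := hT₀ s hs
    unfold N at h3
    have h4 : (Γ.pointsBefore t s).ncard + (Γ.pointsAfter t s).ncard ≤
        ((treeGraph par up).pointsBefore t s).ncard +
          ((treeGraph par up).pointsAfter t s).ncard := by
      have := (div_le_div_iff_of_pos_right (two_pos (α := ℝ))).1 h3
      exact_mod_cast this
    have h5 := Set.eq_of_subset_of_ncard_le (pointsAfter_treeGraph_subset (t := t) hπ0 hπ s)
      (by omega) (Γ.finite_pointsAfter ht s)
    -- A departure at time `s` is itself a point just after `s`, so equality of the sets of points
    -- transfers departures back to the tree.
    have h6 : (d, s) ∈ Γ.pointsAfter t s := ⟨hd, le_rfl, by simpa using ht d.1⟩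
    rw [← h5] at h6
    exact h6.1
  have key : ∀ (e : Fin n) (y : Option (Fin n)), π (some e) = π y → some e = y := by
    intro e y hy
    have htail : (treeGraph par up).tail (e, !up e) = some e :=
      treeGraph_tail_not_up up e
    have htail' : Γ.tail (e, !up e) = π y := by
      rw [← hy, ← htail]
      exact (hπ _ _).symm
    -- At a late departure time of `y`, gluing makes `some e` send out a point too. In the tree the
    -- same `m` is then valid at both vertices, which must coincide.
    obtain ⟨m, hm, hmT⟩ := exists_valid_weight_ge ht e y T₀
    have h1 := (hr.emits_of_valid (t := t) up hm).map_of_treeGraph hπ0 hπ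
    rw [← htail'] at h1
    have h2 := hem _ _ hmT h1
    rw [htail, hr.emits_weight_iff up hind] at h2
    exact hr.valid_unique h2 hm
  intro x y hxy
  cases x with
  | some e => exact key e y hxy
  | none =>
    cases y with
    | none => rfl
    | some f => exact (key f none hxy.symm).symm

end

end SourcedGraph

/-! ### The shape of a minimal tree -/

namespace SourcedGraph

variable {n : ℕ}

section

variable {par : Fin n → Option (Fin n)} {up : Fin n → Bool} {h : Fin n → ℕ}

theorem IsRanked.onPath_tail_iff_head (hr : IsRanked par h) (d : Fin n × Bool) (e : Fin n) :
    (OnPath par ((treeGraph par up).tail d) e ↔ OnPath par ((treeGraph par up).head d) e) ↔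
      e ≠ d.1 := by
  have h1 := hr.not_onPath_par d.1
  rw [treeGraph_tail, treeGraph_head]
  split_ifs
  · rw [onPath_some]
    by_cases he : e = d.1
    · subst he
      simp [h1]
    · simp [he]
  · rw [onPath_some]
    by_cases he : e = d.1
    · subst he
      simp [h1]
    · simp [he]

variable {Γ : SourcedGraph n} {π : Option (Fin n) → Γ.V}

/-- Each step toggles the membership of its own edge in the path from the root and of no other.
Closed walks therefore use every edge an even number of times, which gives acyclicity. -/
theorem IsRanked.odd_count_iff (hr : IsRanked par h)
    (hπ : ∀ e b, π ((treeGraph par up).endpt e b) = Γ.endpt e b) (hinj : Function.Injective π)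
    {x y : Option (Fin n)} {p : List (Fin n × Bool)} (hp : Γ.IsWalk (π x) p (π y)) (e : Fin n) :
    Odd ((p.map Prod.fst).count e) ↔ ¬ (OnPath par x e ↔ OnPath par y e) := by
  induction p generalizing x with
  | nil =>
    obtain rfl := hinj hp
    simp
  | cons d p ih =>
    obtain ⟨h1, h2⟩ := hp
    obtain rfl : (treeGraph par up).tail d = x := hinj ((hπ _ _).trans h1)
    have h3 : π ((treeGraph par up).head d) = Γ.head d := hπ _ _
    rw [← h3] at h2
    have h4 := ih h2
    have h5 := hr.onPath_tail_iff_head (up := up) d e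
    rw [List.map_cons, List.count_cons]
    by_cases he : e = d.1
    · subst he
      simp only [beq_self_eq_true, if_true, Nat.odd_add_one, h4]
      simp only [ne_eq, not_true, iff_false] at h5
      tauto
    · have : (d.1 == e) = false := by simpa using Ne.symm he
      simp only [this, Bool.false_eq_true, if_false, add_zero, h4]
      have h6 := h5.2 he
      tauto

theorem IsRanked.acyclic (hr : IsRanked par h)
    (hπ : ∀ e b, π ((treeGraph par up).endpt e b) = Γ.endpt e b) (hinj : Function.Injective π)
    (hsurj : Function.Surjective π) : Γ.Acyclic := by
  intro v p hp hnd
  obtain ⟨x, rfl⟩ := hsurj v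
  rw [← List.map_eq_nil_iff (f := Prod.fst), List.eq_nil_iff_forall_not_mem]
  intro e he
  have h1 := hr.odd_count_iff hπ hinj hp e
  rw [List.count_eq_one_of_mem hnd he] at h1
  simp at h1

theorem IsRanked.degree_eq (hr : IsRanked par h)
    (hπ : ∀ e b, π ((treeGraph par up).endpt e b) = Γ.endpt e b) (hinj : Function.Injective π)
    (hchild : ∀ g b c, par b = some g → par c = some g → b = c) (g : Fin n) :
    Γ.degree (π (some g)) = 1 ∨ Γ.degree (π (some g)) = 2 := by
  have hset : {d | Γ.tail d = π (some g)} = {d | (treeGraph par up).tail d = some g} := by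
    ext d
    have h1 : Γ.tail d = π ((treeGraph par up).tail d) := (hπ _ _).symm
    simp only [Set.mem_ofPred_eq, h1]
    exact hinj.eq_iff
  have hcases : ∀ d : Fin n × Bool, (treeGraph par up).tail d = some g →
      d = (g, !up g) ∨ par d.1 = some g ∧ d = (d.1, up d.1) := by
    rintro ⟨e, b⟩ hd
    rw [treeGraph_tail] at hd
    split_ifs at hd with hb
    · exact Or.inr ⟨hd, by rw [← hb]⟩
    · obtain rfl := Option.some.inj hd
      refine Or.inl (Prod.ext rfl ?_)
      revert hb
      dsimp only
      cases b <;> cases up e <;> simp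
  unfold degree
  rw [hset]
  by_cases hf : ∃ f, par f = some g
  · obtain ⟨f, hf⟩ := hf
    right
    have hne : (g, !up g) ≠ (f, up f) := by
      intro heq
      rw [← (Prod.mk.inj heq).1] at hf
      exact hr.par_ne g hf
    rw [← Set.ncard_pair hne]
    congr 1
    ext d
    constructor
    · intro hd
      rcases hcases d hd with h1 | ⟨h1, h2⟩
      · exact Or.inl h1
      · rw [hchild g _ _ h1 hf] at h2
        exact Or.inr h2
    · rintro (rfl | rfl)
      · exact treeGraph_tail_not_up up g
      · exact (treeGraph_tail_up up f).trans hf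
  · left
    rw [Set.ncard_eq_one]
    refine ⟨(g, !up g), Set.ext fun d => ⟨fun hd => ?_, ?_⟩⟩
    · rcases hcases d hd with h1 | ⟨h1, -⟩
      · exact h1
      · exact absurd ⟨_, h1⟩ hf
    · rintro rfl
      exact treeGraph_tail_not_up up g

/-- The descending chain of edges that starts with `e`. -/
theorem IsRanked.exists_chain (hr : IsRanked par h)
    (hπ : ∀ e b, π ((treeGraph par up).endpt e b) = Γ.endpt e b)
    (hchild : ∀ g b c, par b = some g → par c = some g → b = c) (e : Fin n) :
    ∃ L : List (Fin n), L.Nodup ∧ (∀ f, f ∈ L ↔ OnPath par (some f) e) ∧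
      ∃ v, Γ.IsWalk (π (par e)) (L.map fun f => (f, up f)) v := by
  have hH : ∀ f, h f ≤ Finset.univ.sup h := fun f => Finset.le_sup (Finset.mem_univ f)
  obtain ⟨k, hk⟩ : ∃ k, Finset.univ.sup h - h e = k := ⟨_, rfl⟩
  induction k using Nat.strong_induction_on generalizing e with
  | _ k ih =>
    have htail : Γ.tail (e, up e) = π (par e) := by
      rw [← treeGraph_tail_up (par := par) up e]
      exact (hπ _ _).symm
    have hhead : Γ.head (e, up e) = π (some e) := by
      rw [← treeGraph_head_up (par := par) up e]
      exact (hπ _ _).symm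
    by_cases hc : ∃ c, par c = some e
    · obtain ⟨c, hc⟩ := hc
      have h1 := hr c e hc
      have h2 := hH c
      obtain ⟨L, hnd, hmem, v, hv⟩ := ih _ (by omega) c rfl
      refine ⟨e :: L, List.nodup_cons.2 ⟨fun he => ?_, hnd⟩, fun f => ?_, v, htail, ?_⟩
      · have := hr.le_of_onPath ((hmem e).1 he)
        omega
      · rw [List.mem_cons, hmem]
        constructor
        · rintro (rfl | hf)
          · exact OnPath.here _
          · exact hf.trans (OnPath.above _ _ (hc ▸ OnPath.here e))
        · intro hf
          by_cases hfe : f = e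
          · exact Or.inl hfe
          · obtain ⟨c', h3, h4⟩ := hf.exists_child hfe
            rw [hchild e c c' hc h3]
            exact Or.inr h4
      · rw [hhead, ← hc]
        exact hv
    · refine ⟨[e], List.nodup_singleton e, fun f => ?_, π (some e), htail, hhead⟩
      rw [List.mem_singleton]
      constructor
      · rintro rfl
        exact OnPath.here _
      · intro hf
        by_contra hfe
        obtain ⟨c', h3, -⟩ := hf.exists_child hfe
        exact hc ⟨c', h3⟩

theorem IsRanked.top_unique (hr : IsRanked par h) {x : Option (Fin n)} {r r' : Fin n}
    (h1 : OnPath par x r) (h2 : OnPath par x r') (hr1 : par r = none) (hr2 : par r' = none) :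
    r = r' := by
  revert h1 h2
  refine hr.induction (P := fun x => OnPath par x r → OnPath par x r' → r = r') ?_ ?_ x
  · exact fun h => absurd h (not_onPath_none r)
  · intro f ih h1 h2
    rcases onPath_some.1 h1 with rfl | h1
    · rcases onPath_some.1 h2 with rfl | h2
      · rfl
      · exact absurd (hr1 ▸ h2) (not_onPath_none r')
    · rcases onPath_some.1 h2 with rfl | h2
      · exact absurd (hr2 ▸ h1) (not_onPath_none r)
      · exact ih h1 h2

theorem IsRanked.exists_top (hr : IsRanked par h) (e : Fin n) :
    ∃ r, par r = none ∧ OnPath par (some e) r := by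
  refine hr.induction (P := fun x => ∀ e, x = some e → ∃ r, par r = none ∧ OnPath par (some e) r)
    ?_ ?_ (some e) e rfl
  · simp
  · intro f ih e he
    obtain rfl := Option.some.inj he
    cases hp : par f with
    | none => exact ⟨f, hp, OnPath.here f⟩
    | some p =>
      obtain ⟨r, h1, h2⟩ := ih p hp
      exact ⟨r, h1, OnPath.above _ _ (hp ▸ h2)⟩

/-- The chains are indexed by the edges at the root: with at most one edge below each edge,
everything below such an edge is a single path. The length bound is conditional on every edge at the
root having an edge below it. -/
theorem IsRanked.exists_isUnionOfRootChains (hr : IsRanked par h) (hπ0 : π none = Γ.root)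
    (hπ : ∀ e b, π ((treeGraph par up).endpt e b) = Γ.endpt e b) (hinj : Function.Injective π)
    (hsurj : Function.Surjective π)
    (hchild : ∀ g b c, par b = some g → par c = some g → b = c) :
    ∃ (k : ℕ) (C : Fin k → List (Fin n × Bool)), Γ.IsUnionOfRootChains C ∧
      ((∀ r, par r = none → ∃ c, par c = some r) → ∀ i, 2 ≤ (C i).length) := by
  classical
  choose L hnd hmem hwalk using hr.exists_chain (Γ := Γ) (π := π) hπ hchild
  let E := Fintype.equivFin {r : Fin n // par r = none}
  have hhead : ∀ l : List (Fin n), (l.map fun f => (f, up f)).map Γ.head =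
      l.map fun f => π (some f) := by
    intro l
    rw [List.map_map]
    refine List.map_congr_left fun f _ => ?_
    change Γ.head (f, up f) = π (some f)
    rw [← treeGraph_head_up (par := par) up f]
    exact (hπ _ _).symm
  have hfst : ∀ l : List (Fin n), (l.map fun f => (f, up f)).map Prod.fst = l := by
    intro l
    simp [List.map_map, Function.comp_def]
  refine ⟨_, fun i => (L (E.symm i).1).map fun f => (f, up f), ⟨fun i => ?_, fun i j hij => ?_,
    fun e => ?_, fun v => ?_⟩, fun hlong i => ?_⟩
  · dsimp only
    generalize E.symm i = r
    obtain ⟨r, hroot⟩ := r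
    refine ⟨?_, ?_, ?_⟩
    · have := (hmem r r).2 (OnPath.here r)
      simpa using List.ne_nil_of_mem this
    · have := hwalk r
      rwa [hroot, hπ0] at this
    · rw [hhead, List.nodup_cons]
      constructor
      · rw [← hπ0, List.mem_map]
        rintro ⟨f, -, hf⟩
        simpa using hinj hf
      · exact (hnd r).map (hinj.comp (Option.some_injective _))
  · intro v hv hv'
    rw [hhead, List.mem_map] at hv hv'
    obtain ⟨f, hf, rfl⟩ := hv
    obtain ⟨f', hf', heq⟩ := hv'
    obtain rfl := Option.some.inj (hinj heq)
    apply hij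
    apply E.symm.injective
    exact Subtype.ext (hr.top_unique ((hmem _ _).1 hf) ((hmem _ _).1 hf') (E.symm i).2 (E.symm j).2)
  · obtain ⟨r, h1, h2⟩ := hr.exists_top e
    refine ⟨E ⟨r, h1⟩, ?_, fun i hi => ?_⟩
    · dsimp only
      rw [hfst, E.symm_apply_apply]
      exact (hmem _ _).2 h2
    · dsimp only at hi
      rw [hfst] at hi
      rw [← E.symm_apply_eq]
      exact Subtype.ext (hr.top_unique ((hmem _ _).1 hi) h2 (E.symm i).2 h1)
  · obtain ⟨x, rfl⟩ := hsurj v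
    cases x with
    | none => exact Or.inl hπ0
    | some e =>
      obtain ⟨r, h1, h2⟩ := hr.exists_top e
      refine Or.inr ⟨E ⟨r, h1⟩, ?_⟩
      rw [hhead, E.symm_apply_apply]
      exact List.mem_map_of_mem (f := fun f => π (some f)) ((hmem _ _).2 h2)
  · dsimp only
    generalize E.symm i = r
    obtain ⟨r, hroot⟩ := r
    obtain ⟨c, hc⟩ := hlong r hroot
    have h1 := (hmem r r).2 (OnPath.here r)
    have h2 := (hmem r c).2 (OnPath.above _ _ (hc ▸ OnPath.here r))
    have hne : r ≠ c := by
      rintro rfl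
      exact hr.par_ne r hc
    rw [List.length_map]
    dsimp only
    rcases hL : L r with _ | ⟨a, _ | ⟨a', l⟩⟩
    · simp [hL] at h1
    · simp only [hL, List.mem_singleton] at h1 h2
      exact absurd (h1.trans h2.symm) hne
    · simp

variable {t : Fin n → ℝ} {𝒢 : Set (SourcedGraph n)}

theorem GrowsNoFaster.trans {Γ₁ Γ₂ Γ₃ : SourcedGraph n} (h12 : GrowsNoFaster t Γ₁ Γ₂)
    (h23 : GrowsNoFaster t Γ₂ Γ₃) : GrowsNoFaster t Γ₁ Γ₃ := by
  filter_upwards [h12, h23] with T h1 h2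
  exact h1.trans h2

theorem GrowsMinimally.child_unique (ht : ∀ e, 0 < t e) (hind : LinearIndependent ℚ t)
    (h𝒢 : 𝒢 = {Γ | Γ.Connected} ∨ 𝒢 = {Γ | Γ.Connected ∧ Γ.IsSimple})
    (hr : IsRanked par h) (hmin : GrowsMinimally t 𝒢 (treeGraph par up)) {g b c : Fin n}
    (hb : par b = some g) (hc : par c = some g) : b = c := by
  by_contra hbc
  have hr' := hr.liftBranch hb
  obtain ⟨T₀, hT₀⟩ := exists_ncard_treeBirths_lt ht hind hr hb hc hbc
  have hlt : ∀ T, T₀ < T →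
      (treeGraph (liftBranch par b g) up).N t T < (treeGraph par up).N t T := by
    intro T hT
    refine N_lt_of_births_lt ht (fun T hT => ?_) hT
    rw [hr'.ncard_births up hind, hr.ncard_births up hind]
    exact hT₀ T hT
  have h1 : GrowsNoFaster t (treeGraph (liftBranch par b g) up) (treeGraph par up) := by
    filter_upwards [Filter.eventually_gt_atTop T₀] with T hT
    exact (hlt T hT).le
  obtain ⟨T, h2, h3⟩ := ((hmin.2 _ (hr'.treeGraph_mem h𝒢) h1).and
    (Filter.eventually_gt_atTop T₀)).exists
  exact (hlt T h3).not_ge h2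

theorem GrowsMinimally.exists_child (ht : ∀ e, 0 < t e) (hind : LinearIndependent ℚ t)
    (h𝒢 : 𝒢 = {Γ | Γ.Connected} ∨ 𝒢 = {Γ | Γ.Connected ∧ Γ.IsSimple})
    (hr : IsRanked par h) (hmin : GrowsMinimally t 𝒢 (treeGraph par up)) (hn : 2 ≤ n) {f : Fin n}
    (hf : par f = none) : ∃ c, par c = some f := by
  by_contra! hleaf
  obtain ⟨e, hef, he⟩ : ∃ e, e ≠ f ∧ par e = none := by
    have : Nontrivial (Fin n) := Fin.nontrivial_iff_two_le.2 hn
    obtain ⟨e₀, he₀⟩ := exists_ne f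
    obtain ⟨r, h1, h2⟩ := hr.exists_top e₀
    refine ⟨r, ?_, h1⟩
    rintro rfl
    obtain ⟨c, hc, -⟩ := h2.exists_child he₀
    exact hleaf c hc
  have htail : (treeGraph par up).tail (f, !up f) = some f := treeGraph_tail_not_up up f
  obtain ⟨h1, h2⟩ := (treeGraph par up).reroot_growth ht hind (d₀ := (f, !up f)) (d₁ := (e, up e))
    ((treeGraph_head_not_up up f).trans hf) (by
      rintro ⟨a, b⟩ hd
      replace hd := ((treeGraph_tail up (a, b)).symm.trans hd).trans htail
      split_ifs at hd with hb
      · exact absurd hd (hleaf a)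
      · obtain rfl := Option.some.inj hd
        refine Prod.ext rfl ?_
        revert hb
        dsimp only
        cases b <;> cases up a <;> simp) ((treeGraph_tail_up up e).trans he) hef
  refine h2 (hmin.2 _ ?_ h1)
  have hconn := (treeGraph par up).reroot_connected
    (x := (treeGraph par up).tail (f, !up f)) hr.treeGraph_connected
  rcases h𝒢 with rfl | rfl
  · exact hconn
  · exact ⟨hconn, hr.treeGraph_isSimple (up := up)⟩

end

end SourcedGraph

theorem theorem1 (n : ℕ) (t : Fin n → ℝ) (ht : ∀ e, 0 < t e) (hind : LinearIndependent ℚ t)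
    (𝒢 : Set (SourcedGraph n))
    (h𝒢 : 𝒢 = {Γ | Γ.Connected} ∨ 𝒢 = {Γ | Γ.Connected ∧ Γ.IsSimple})
    (Γ : SourcedGraph n) (hΓ : SourcedGraph.GrowsMinimally t 𝒢 Γ) :
    Γ.IsTree ∧
    (∀ v : Γ.V, v ≠ Γ.root → Γ.degree v = 1 ∨ Γ.degree v = 2) ∧
    ∃ (k : ℕ) (C : Fin k → List (Fin n × Bool)),
      Γ.IsUnionOfRootChains C ∧ (2 ≤ n → ∀ i, 2 ≤ (C i).length) := by
  have hconn : Γ.Connected := by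
    have := hΓ.1
    rcases h𝒢 with rfl | rfl
    · exact this
    · exact this.1
  obtain ⟨par, up, h, π, hr, hπ0, hπ, hsurj⟩ := hconn.exists_treeGraph
  have hle : SourcedGraph.GrowsNoFaster t (SourcedGraph.treeGraph par up) Γ :=
    Filter.Eventually.of_forall (SourcedGraph.N_treeGraph_le ht hπ0 hπ)
  have hmem : SourcedGraph.treeGraph par up ∈ 𝒢 := hr.treeGraph_mem h𝒢
  have hge := hΓ.2 _ hmem hle
  have hinj := SourcedGraph.injective_of_growsNoFaster hr ht hind hπ0 hπ hge
  -- The tree grows no faster than `Γ`, so it inherits minimality and the modifications of trees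
  -- apply to it.
  have hmin : SourcedGraph.GrowsMinimally t 𝒢 (SourcedGraph.treeGraph par up) :=
    ⟨hmem, fun Γ' hΓ' h1 => hle.trans (hΓ.2 Γ' hΓ' (h1.trans hle))⟩
  have hchild : ∀ g b c, par b = some g → par c = some g → b = c := fun g b c hb hc =>
    hmin.child_unique ht hind h𝒢 hr hb hc
  refine ⟨⟨hconn, hr.acyclic hπ hinj hsurj⟩, fun v hv => ?_, ?_⟩
  · obtain ⟨x, rfl⟩ := hsurj v
    cases x with
    | none => exact absurd hπ0 hv
    | some g => exact hr.degree_eq hπ hinj hchild g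
  · obtain ⟨k, C, hC, hlong⟩ := hr.exists_isUnionOfRootChains hπ0 hπ hinj hsurj hchild
    exact ⟨k, C, hC, fun hn => hlong fun r hroot => hmin.exists_child ht hind h𝒢 hr hn hroot⟩
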